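/- Let $n,N,d,r$ be natural numbers, let $X_S\in\mathbb{R}^{n\times d}$, $X_B\in\mathbb{R}^{N\times d}$ and $X_T\in\mathbb{R}^{r\times d}$ be fixed matrices with $X_S^{\mathsf T}X_S=n\Sigma$, $X_B^{\mathsf T}X_B=V_B$ and $X_T^{\mathsf T}X_T=\Sigma$, where $\Sigma$ and $V_B$ both have rank $d$ ($V_B$ need not be proportional to $\Sigma$). Suppose that $d\ge 5$ and $m=n-d\ge 10$. (1) Let $\beta,\gamma\in\mathbb{R}^d$, $\sigma_S>0$, $\sigma_B\ge 0$, and let $Y_S\sim\mathcal{N}(X_S\beta,\sigma_S^2I_n)$ be independent of $Y_B\sim\mathcal{N}(X_B(\beta+\gamma),\sigma_B^2I_N)$. Put $\hat\beta_S=(X_S^{\mathsf T}X_S)^{-1}X_S^{\mathsf T}Y_S$, $\hat\beta_B=(X_B^{\mathsf T}X_B)^{-1}X_B^{\mathsf T}Y_B$, $\hat\gamma=\hat\beta_B-\hat\beta_S$, $\hat\sigma_S^2=\Vert Y_S-X_S\hat\beta_S\Vert^2/(n-d)$ and $\hat\sigma_B^2=\Vert Y_B-X_B\hat\beta_B\Vert^2/(N-d)$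 (read as $0$ if $N=d$), where $\Vert\cdot\Vert$ is the Euclidean norm. Let $h$ be a real measurable function that is nonnegative on $[0,\infty)$ and satisfies $\mathbb{E}(h(\hat\sigma_B^2))<\infty$, and let $$\hat\omega=\hat\omega_{\mathrm{plug},h}=\frac{\hat\gamma^{\mathsf T}\Sigma\hat\gamma+h(\hat\sigma_B^2)}{\hat\gamma^{\mathsf T}\Sigma\hat\gamma+h(\hat\sigma_B^2)+d\hat\sigma_S^2/n},\qquad \hat\beta(\hat\omega)=\hat\omega\hat\beta_S+(1-\hat\omega)\hat\beta_B .$$ Then $$\mathbb{E}\bigl(\Vert X_T\hat\beta(\hat\omega)-X_T\beta\Vert^2\bigr)<\mathbb{E}\bigl(\Vert X_T\hat\beta_S-X_T\beta\Vert^2\bigr),$$ and both expectations are finite. (2) Consequently $\hat\beta_S$ is inadmissible as an estimator of $\beta$ from the data $(Y_S,Y_B)$ under the loss $\Vert X_T b-X_T\beta\Vert^2$: there is a measurable function of $(Y_S,Y_B)$ with values in $\mathbb{R}^d$ whose risk is at most that of $\hat\beta_S$ for all parameters $(\beta,\gamma,\sigma_S,\sigma_B)$ with $\sigma_S>0$ and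 $\sigma_B\ge 0$, and strictly smaller for at least one of them. -/

import Mathlib

open MeasureTheory ProbabilityTheory
open scoped Matrix ENNReal

noncomputable section

namespace DataEnriched

/-- The least squares estimator `(Xᵀ X)⁻¹ Xᵀ y` (used for designs `X` of full column rank). -/
def ols {n d : ℕ} (X : Matrix (Fin n) (Fin d) ℝ) (y : EuclideanSpace ℝ (Fin n)) :
    EuclideanSpace ℝ (Fin d) :=
  Matrix.toEuclideanLin ((Xᵀ * X)⁻¹ * Xᵀ) y

/-- The residual variance estimator `‖y - X β̂‖² / (n - d)`, with `β̂` the least squares fit.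
The subtraction is in `ℝ`; when `n = d` the value is `0`. -/
def residVar {n d : ℕ} (X : Matrix (Fin n) (Fin d) ℝ) (y : EuclideanSpace ℝ (Fin n)) : ℝ :=
  ‖y - Matrix.toEuclideanLin X (ols X y)‖ ^ 2 / ((n : ℝ) - (d : ℝ))

/-- The quadratic form `gᵀ M g`. -/
def quadForm {d : ℕ} (M : Matrix (Fin d) (Fin d) ℝ) (g : EuclideanSpace ℝ (Fin d)) : ℝ :=
  g.ofLp ⬝ᵥ (M *ᵥ g.ofLp)

/-- The generalized plug-in weight
`(γ̂ᵀ Σ γ̂ + h(σ̂_B²)) / (γ̂ᵀ Σ γ̂ + h(σ̂_B²) + d σ̂_S² / n)`, where `γ̂ = β̂_B - β̂_S`. -/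
def plugInWeight {n N d : ℕ} (Sig : Matrix (Fin d) (Fin d) ℝ)
    (XS : Matrix (Fin n) (Fin d) ℝ) (XB : Matrix (Fin N) (Fin d) ℝ) (h : ℝ → ℝ)
    (yS : EuclideanSpace ℝ (Fin n)) (yB : EuclideanSpace ℝ (Fin N)) : ℝ :=
  (quadForm Sig (ols XB yB - ols XS yS) + h (residVar XB yB)) /
    (quadForm Sig (ols XB yB - ols XS yS) + h (residVar XB yB)
      + (d : ℝ) * residVar XS yS / (n : ℝ))

/-- The data-enriched weighted estimator `ω̂ β̂_S + (1 - ω̂) β̂_B` with `ω̂` the generalized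
plug-in weight. -/
def enriched {n N d : ℕ} (Sig : Matrix (Fin d) (Fin d) ℝ)
    (XS : Matrix (Fin n) (Fin d) ℝ) (XB : Matrix (Fin N) (Fin d) ℝ) (h : ℝ → ℝ)
    (yS : EuclideanSpace ℝ (Fin n)) (yB : EuclideanSpace ℝ (Fin N)) :
    EuclideanSpace ℝ (Fin d) :=
  plugInWeight Sig XS XB h yS yB • ols XS yS
    + (1 - plugInWeight Sig XS XB h yS yB) • ols XB yB

/-- The law `N(X b, σ² I)` of the response vector in a Gaussian linear model. -/
def linearModel {n d : ℕ} (X : Matrix (Fin n) (Fin d) ℝ) (b : EuclideanSpace ℝ (Fin d)) (σ : ℝ) :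
    Measure (EuclideanSpace ℝ (Fin n)) :=
  multivariateGaussian (Matrix.toEuclideanLin X b) (σ ^ 2 • (1 : Matrix (Fin n) (Fin n) ℝ))

/-- The unknown parameters of the two-sample model: the coefficient `β` of the small sample, the
bias `γ` of the big sample, and the two error standard deviations. -/
structure Params (d : ℕ) where
  β : EuclideanSpace ℝ (Fin d)
  γ : EuclideanSpace ℝ (Fin d)
  σS : ℝ
  σB : ℝ
  σS_pos : 0 < σS
  σB_nonneg : 0 ≤ σB

/-- The joint law of the independent pair `(Y_S, Y_B)` of small and big sample responses. -/
def jointModel {n N d : ℕ} (XS : Matrix (Fin n) (Fin d) ℝ) (XB : Matrix (Fin N) (Fin d) ℝ)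
    (θ : Params d) : Measure (EuclideanSpace ℝ (Fin n) × EuclideanSpace ℝ (Fin N)) :=
  (linearModel XS θ.β θ.σS).prod (linearModel XB (θ.β + θ.γ) θ.σB)

/-- The squared prediction loss `‖X_T b - X_T β‖²`, as an extended nonnegative number. -/
def predLoss {r d : ℕ} (XT : Matrix (Fin r) (Fin d) ℝ) (θ : Params d)
    (b : EuclideanSpace ℝ (Fin d)) : ℝ≥0∞ :=
  ENNReal.ofReal (‖Matrix.toEuclideanLin XT b - Matrix.toEuclideanLin XT θ.β‖ ^ 2)

/-- The risk function of the estimator `δ` in the statistical model `P`. -/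
def risk {Θ D A : Type*} [MeasurableSpace D] (P : Θ → Measure D) (loss : Θ → A → ℝ≥0∞)
    (δ : D → A) (θ : Θ) : ℝ≥0∞ :=
  ∫⁻ y, loss θ (δ y) ∂(P θ)

/-- `δ₀` is inadmissible: some estimator has risk at most that of `δ₀` at every parameter and
strictly smaller risk at some parameter. -/
def Inadmissible {Θ D A : Type*} [MeasurableSpace D] [MeasurableSpace A] (P : Θ → Measure D)
    (loss : Θ → A → ℝ≥0∞) (δ₀ : D → A) : Prop :=
  ∃ δ : D → A, Measurable δ ∧ (∀ θ, risk P loss δ θ ≤ risk P loss δ₀ θ) ∧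
    ∃ θ, risk P loss δ θ < risk P loss δ₀ θ

end DataEnriched

end

/-! ### Stein's identity for the standard Gaussian on a Euclidean space. -/

section Stein

open Module
open scoped RealInnerProductSpace

variable {E : Type*} [NormedAddCommGroup E] [InnerProductSpace ℝ E]

/-! Because `XTᵀ * XT = Sig` and `XSᵀ * XS = n • Sig`, the prediction loss is `1/n` times the loss
of the fitted values `XS b`. Fix `Y_B` and write `Y_S = XS β + σ x` with `x` standard Gaussian. Let
`P` project onto `K = range XS`, of dimension `d`, and `Q = 1 - P`, of rank `m = n - d`. Least
squares has error `σ P x`, and the enriched estimator has error `σ (P x - φ (P x - b))`. Here `b ∈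
K` is fixed and `φ = k‖Q x‖² / (‖P x - b‖² + k‖Q x‖² + c)`, with `k = d/m` and `c = n h(σ̂_B²)/σ²`.
So this is James-Stein shrinkage of `P x` towards `b`, with the variance estimated from the
independent `Q x`.

Expanding the square leaves a cross term and a quadratic term. Put `ρ = ‖P x - b‖² / (‖P x - b‖² +
k‖Q x‖² + c)`. Stein's identity for `φ (P x - b)` gives `E φ⟨P x, P x - b⟩ = E (dφ - 2φρ)`. The
quadratic term is at most `k‖Q x‖²(φ - φ²)`, and Stein's identity for `(φ - φ²) Q x` gives `E (φ -
φ²)‖Q x‖² = E (φ - φ²)(m + 2(1 - 2φ))`. Since `km = d`, `φρ ≤ φ - φ²` and `4 + 2k ≤ d`, the change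
in risk is at most `-2d E φ² < 0` (`integral_norm_shrink_sq_lt`). Averaging over the independent
`Y_B` gives `enriched_dominates_ols`; inadmissibility is the case `h = 0`. -/

lemma hasFDerivAt_exp_neg_half_sq_norm (x : E) :
    HasFDerivAt (fun x : E => Real.exp (-‖x‖ ^ 2 / 2))
      (-Real.exp (-‖x‖ ^ 2 / 2) • innerSL ℝ x) x := by
  have h := (((hasStrictFDerivAt_norm_sq x).hasFDerivAt.neg.mul_const (1 / 2)).exp)
  convert h using 1
  · ext y; simp [div_eq_mul_inv]
  · ext y; simp [div_eq_mul_inv]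

variable [FiniteDimensional ℝ E] [MeasurableSpace E] [BorelSpace E]

lemma integrable_exp_neg_half_sq_norm :
    Integrable (fun x : E => Real.exp (-‖x‖ ^ 2 / 2)) := by
  have h := GaussianFourier.integrable_cexp_neg_mul_sq_norm_add (V := E) (b := 1 / 2)
    (by norm_num) 0 0
  refine h.norm.congr (.of_forall fun x => ?_)
  simp only [Complex.norm_exp]
  congr 1
  simp [← Complex.ofReal_pow]
  ring

lemma integral_exp_neg_half_sq_norm_pos :
    0 < ∫ x : E, Real.exp (-‖x‖ ^ 2 / 2) :=
  integral_exp_pos integrable_exp_neg_half_sq_norm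

/-- Both measures have the same characteristic function, by the Gaussian Fourier integral; its value
at zero frequency is the normalising constant. -/
lemma stdGaussian_eq_withDensity :
    stdGaussian E = (volume : Measure E).withDensity (fun x => ENNReal.ofReal
      ((∫ y : E, Real.exp (-‖y‖ ^ 2 / 2))⁻¹ * Real.exp (-‖x‖ ^ 2 / 2))) := by
  have hint := (integrable_exp_neg_half_sq_norm (E := E)).const_mul
    (∫ y : E, Real.exp (-‖y‖ ^ 2 / 2))⁻¹
  have hpos := integral_exp_neg_half_sq_norm_pos (E := E)
  have : IsFiniteMeasure ((volume : Measure E).withDensity (fun x => ENNReal.ofReal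
      ((∫ y : E, Real.exp (-‖y‖ ^ 2 / 2))⁻¹ * Real.exp (-‖x‖ ^ 2 / 2)))) :=
    isFiniteMeasure_withDensity_ofReal hint.2
  have hC : ((∫ y : E, Real.exp (-‖y‖ ^ 2 / 2) : ℝ) : ℂ)
      = ((Real.pi / (1 / 2) : ℂ)) ^ (finrank ℝ E / 2 : ℂ) := by
    have h := GaussianFourier.integral_cexp_neg_mul_sq_norm (V := E) (b := 1 / 2) (by norm_num)
    rw [← h, ← integral_complex_ofReal]
    congr 1 with x
    push_cast
    congr 1
    ring
  apply Measure.ext_of_charFun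
  ext t
  rw [charFun_stdGaussian, charFun_apply,
    integral_withDensity_eq_integral_toReal_smul (by fun_prop) (by simp)]
  have h := GaussianFourier.integral_cexp_neg_mul_sq_norm_add (V := E) (b := 1 / 2)
    (by norm_num) Complex.I t
  rw [← hC] at h
  have h2 : ∀ x : E, (ENNReal.ofReal ((∫ y : E, Real.exp (-‖y‖ ^ 2 / 2))⁻¹
      * Real.exp (-‖x‖ ^ 2 / 2))).toReal • Complex.exp (⟪x, t⟫ * Complex.I)
      = ((∫ y : E, Real.exp (-‖y‖ ^ 2 / 2) : ℝ) : ℂ)⁻¹ *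
        Complex.exp (-(1 / 2) * ‖x‖ ^ 2 + Complex.I * ⟪t, x⟫) := by
    intro x
    rw [ENNReal.toReal_ofReal (by positivity), Complex.exp_add, Complex.real_smul,
      real_inner_comm]
    push_cast
    rw [show (-(‖x‖ : ℂ) ^ 2 / 2) = -(1 / 2) * ‖x‖ ^ 2 by ring, mul_comm Complex.I, mul_assoc]
  simp_rw [h2]
  rw [integral_const_mul, h, ← mul_assoc, inv_mul_cancel₀ (by exact_mod_cast hpos.ne'), one_mul]
  congr 1
  rw [Complex.I_sq]
  ring

lemma integrable_stdGaussian_iff {f : E → ℝ} :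
    Integrable f (stdGaussian E) ↔ Integrable (fun x => f x * Real.exp (-‖x‖ ^ 2 / 2)) := by
  have hpos := integral_exp_neg_half_sq_norm_pos (E := E)
  rw [stdGaussian_eq_withDensity,
    integrable_withDensity_iff_integrable_smul' (by fun_prop) (by simp)]
  have : (fun x : E => (ENNReal.ofReal ((∫ y : E, Real.exp (-‖y‖ ^ 2 / 2))⁻¹
      * Real.exp (-‖x‖ ^ 2 / 2))).toReal • f x) = fun x => (∫ y : E, Real.exp (-‖y‖ ^ 2 / 2))⁻¹ *
        (f x * Real.exp (-‖x‖ ^ 2 / 2)) := by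
    ext x
    rw [ENNReal.toReal_ofReal (by positivity), smul_eq_mul]
    ring
  rw [this, integrable_const_mul_iff (by simpa using hpos.ne')]

lemma integral_stdGaussian (f : E → ℝ) :
    ∫ x, f x ∂(stdGaussian E) = (∫ y : E, Real.exp (-‖y‖ ^ 2 / 2))⁻¹ *
      ∫ x, f x * Real.exp (-‖x‖ ^ 2 / 2) := by
  have hpos := integral_exp_neg_half_sq_norm_pos (E := E)
  rw [stdGaussian_eq_withDensity,
    integral_withDensity_eq_integral_toReal_smul (by fun_prop) (by simp), ← integral_const_mul]
  congr 1 with x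
  rw [ENNReal.toReal_ofReal (by positivity), smul_eq_mul]
  ring

/-- **Stein's identity** in the direction `v`. -/
lemma integral_inner_mul_stdGaussian {f : E → ℝ} {f' : E → E →L[ℝ] ℝ} (v : E)
    (hf : ∀ x, HasFDerivAt f (f' x) x) (h0 : Integrable f (stdGaussian E))
    (h1 : Integrable (fun x => ⟪v, x⟫ * f x) (stdGaussian E))
    (h2 : Integrable (fun x => f' x v) (stdGaussian E)) :
    ∫ x, ⟪v, x⟫ * f x ∂(stdGaussian E) = ∫ x, f' x v ∂(stdGaussian E) := by
  rw [integrable_stdGaussian_iff] at h0 h1 h2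
  rw [integral_stdGaussian, integral_stdGaussian]
  congr 1
  -- Integration by parts along `v`: the derivative of the Gaussian weight produces the factor `-⟪v,
  -- x⟫`.
  have key := integral_bilinear_hasFDerivAt_right_eq_neg_left_of_integrable
    (μ := (volume : Measure E)) (B := ContinuousLinearMap.mul ℝ ℝ)
    (f := f) (g := fun x => Real.exp (-‖x‖ ^ 2 / 2)) (v := v) (f' := f')
    (g' := fun x => -Real.exp (-‖x‖ ^ 2 / 2) • innerSL ℝ x) h2
    (h1.neg.congr (.of_forall fun x => by simp [real_inner_comm]; ring)) h0
    (fun x _ => hf x) (fun x _ => hasFDerivAt_exp_neg_half_sq_norm x)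
  rw [← neg_inj]
  simp only [ContinuousLinearMap.mul_apply'] at key
  rw [← key, ← integral_neg]
  congr 1 with x
  simp [real_inner_comm]
  ring

lemma integrable_norm_pow_stdGaussian (k : ℕ) :
    Integrable (fun x : E => ‖x‖ ^ k) (stdGaussian E) :=
  (IsGaussian.memLp_id (stdGaussian E) k (by simp)).integrable_norm_pow'

lemma integrable_stdGaussian_of_bound {f : E → ℝ} (hf : Measurable f) (C : ℝ) (k : ℕ)
    (h : ∀ x, |f x| ≤ C * (1 + ‖x‖) ^ k) : Integrable f (stdGaussian E) := by
  have : Integrable (fun x : E => C * (1 + ‖x‖) ^ k) (stdGaussian E) := by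
    simp_rw [add_pow, one_pow, one_mul]
    refine (integrable_finsetSum _ fun i _ => ?_).const_mul C
    exact (integrable_norm_pow_stdGaussian _).mul_const _
  exact this.mono' hf.aestronglyMeasurable (.of_forall h)

/-- **Stein's identity** for the vector field `x ↦ f x • (A x + b)`. -/
lemma integral_mul_inner_affine_stdGaussian {f : E → ℝ} {f' : E → E →L[ℝ] ℝ}
    (hf : ∀ x, HasFDerivAt f (f' x) x) (hm : ∀ v, Measurable fun x => f' x v)
    {C : ℝ} (h0 : ∀ x, |f x| ≤ C) (h1 : ∀ x, ‖f' x‖ ≤ C * (1 + ‖x‖)) (A : E →L[ℝ] E) (b : E) :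
    ∫ x, (f x * ⟪x, A x + b⟫ - f' x (A x + b) - f x * LinearMap.trace ℝ E A)
      ∂(stdGaussian E) = 0 := by
  have hfm : Measurable f :=
    (continuous_iff_continuousAt.2 fun x => (hf x).continuousAt).measurable
  have hC : 0 ≤ C := (abs_nonneg _).trans (h0 0)
  let e := stdOrthonormalBasis ℝ E
  -- These are the coordinates of the field; summing their diagonal derivatives gives its divergence
  -- `f' x (A x + b) + f x * tr A`.
  let F : Fin (finrank ℝ E) → E → ℝ := fun i x => f x * ⟪e i, A x + b⟫
  let F' : Fin (finrank ℝ E) → E → E →L[ℝ] ℝ := fun i x =>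
    f x • ((innerSL ℝ (e i)).comp A) + ⟪e i, A x + b⟫ • f' x
  have hF : ∀ i x, HasFDerivAt (F i) (F' i x) x := by
    intro i x
    refine (hf x).mul ?_
    exact (innerSL ℝ (e i)).hasFDerivAt.comp x (A.hasFDerivAt.add_const b)
  let M := ‖A‖ + ‖b‖
  have hAb : ∀ x, ‖A x + b‖ ≤ M * (1 + ‖x‖) := fun x => by
    have := A.le_opNorm x
    have := norm_add_le (A x) b
    simp only [M]
    nlinarith [norm_nonneg b, norm_nonneg A, norm_nonneg x]
  have hM : 0 ≤ M := by positivity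
  have hei : ∀ i y, |⟪e i, y⟫| ≤ ‖y‖ := fun i y => by
    simpa [e.orthonormal.1 i] using abs_real_inner_le_norm (e i) y
  have hF0 : ∀ i x, |F i x| ≤ C * M * (1 + ‖x‖) := fun i x => by
    rw [abs_mul, mul_assoc]
    exact mul_le_mul (h0 x) ((hei _ _).trans (hAb x)) (abs_nonneg _) hC
  have i0 : ∀ i, Integrable (F i) (stdGaussian E) := fun i =>
    integrable_stdGaussian_of_bound (by fun_prop) (C * M) 1 (by simpa using hF0 i)
  have i1 : ∀ i, Integrable (fun x => ⟪e i, x⟫ * F i x) (stdGaussian E) := fun i => by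
    refine integrable_stdGaussian_of_bound (by fun_prop) (C * M) 2 fun x => ?_
    rw [abs_mul]
    calc |⟪e i, x⟫| * |F i x| ≤ (1 + ‖x‖) * (C * M * (1 + ‖x‖)) :=
          mul_le_mul ((hei _ _).trans (by linarith)) (hF0 i x) (abs_nonneg _) (by positivity)
      _ = _ := by ring
  have hm' : ∀ x, ∀ w, f' x w = ∑ j, ⟪e j, w⟫ * f' x (e j) := fun x w => by
    conv_lhs => rw [← e.sum_repr' w]
    simp
  have i2 : ∀ i, Integrable (fun x => F' i x (e i)) (stdGaussian E) := fun i => by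
    have hmm := hm (e i)
    refine integrable_stdGaussian_of_bound ?_ (C * ‖A‖ + C * M) 2 fun x => ?_
    · simp only [F', add_apply, smul_apply, smul_eq_mul]
      fun_prop
    · simp only [F', add_apply, smul_apply, smul_eq_mul,
        ContinuousLinearMap.comp_apply, innerSL_apply_apply]
      have a1 : |f x * ⟪e i, A (e i)⟫| ≤ C * ‖A‖ := by
        rw [abs_mul]
        refine mul_le_mul (h0 x) ((hei _ _).trans ?_) (abs_nonneg _) hC
        simpa [e.orthonormal.1 i] using A.le_opNorm (e i)
      have a2 : |⟪e i, A x + b⟫ * f' x (e i)| ≤ (M * (1 + ‖x‖)) * (C * (1 + ‖x‖)) := by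
        rw [abs_mul]
        refine mul_le_mul ((hei _ _).trans (hAb x)) ?_ (abs_nonneg _) (by positivity)
        refine ((f' x).le_opNorm (e i)).trans ?_
        simpa [e.orthonormal.1 i] using h1 x
      have a3 : C * ‖A‖ ≤ C * ‖A‖ * (1 + ‖x‖) ^ 2 := by
        refine le_mul_of_one_le_right (by positivity) (one_le_pow₀ (by simp))
      calc _ ≤ _ := abs_add_le _ _
        _ ≤ _ := add_le_add a1 a2
        _ ≤ _ := by nlinarith
  have hs : ∑ i, ∫ x, (⟪e i, x⟫ * F i x - F' i x (e i)) ∂(stdGaussian E) = 0 := by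
    refine Finset.sum_eq_zero fun i _ => ?_
    rw [integral_sub (i1 i) (i2 i),
      integral_inner_mul_stdGaussian (e i) (hF i) (i0 i) (i1 i) (i2 i), sub_self]
  rw [← hs, ← integral_finsetSum _ fun i _ => by exact (i1 i).sub (i2 i)]
  congr 1 with x
  rw [hm', ← e.sum_inner_mul_inner, LinearMap.trace_eq_sum_inner _ e, Finset.mul_sum,
    Finset.mul_sum, ← Finset.sum_sub_distrib, ← Finset.sum_sub_distrib]
  refine Finset.sum_congr rfl fun i _ => ?_
  simp only [F', F, add_apply, smul_apply, smul_eq_mul,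
        ContinuousLinearMap.comp_apply, innerSL_apply_apply, ContinuousLinearMap.coe_coe,
        real_inner_comm x]
  ring

end Stein

/-! ### Pointwise calculus of the shrinkage factor. -/

section Shrinkage

open Module Filter Topology
open scoped RealInnerProductSpace

variable {E : Type*} [NormedAddCommGroup E] [InnerProductSpace ℝ E] [FiniteDimensional ℝ E]

/-- The denominator `‖P x - b‖² + k ‖(1 - P) x‖² + c` of the shrinkage factor, where `P` is the
orthogonal projection onto `K`. -/
noncomputable def shrinkDen (K : Submodule ℝ E) (k : ℝ) (b : E) (c : ℝ) (x : E) : ℝ :=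
  ‖K.starProjection x - b‖ ^ 2 + k * ‖Kᗮ.starProjection x‖ ^ 2 + c

/-- The factor by which `P x` is shrunk towards `b`. -/
noncomputable def shrinkFactor (K : Submodule ℝ E) (k : ℝ) (b : E) (c : ℝ) (x : E) : ℝ :=
  k * ‖Kᗮ.starProjection x‖ ^ 2 / shrinkDen K k b c x

/-- The share of `‖P x - b‖²` in the denominator of the shrinkage factor. -/
noncomputable def shrinkRatio (K : Submodule ℝ E) (k : ℝ) (b : E) (c : ℝ) (x : E) : ℝ :=
  ‖K.starProjection x - b‖ ^ 2 / shrinkDen K k b c x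

/-- The derivative of the denominator of the shrinkage factor. -/
noncomputable def shrinkDenDeriv (K : Submodule ℝ E) (k : ℝ) (b : E) (x : E) : E →L[ℝ] ℝ :=
  (2 : ℝ) • (innerSL ℝ (K.starProjection x - b)).comp K.starProjection
    + k • (2 : ℝ) • (innerSL ℝ (Kᗮ.starProjection x)).comp Kᗮ.starProjection

/-- The derivative of the shrinkage factor. -/
noncomputable def shrinkFactorDeriv (K : Submodule ℝ E) (k : ℝ) (b : E) (c : ℝ) (x : E) :
    E →L[ℝ] ℝ :=
  (shrinkDen K k b c x ^ 2)⁻¹ • (shrinkDen K k b c x •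
    (k • (2 : ℝ) • (innerSL ℝ (Kᗮ.starProjection x)).comp Kᗮ.starProjection)
    - (k * ‖Kᗮ.starProjection x‖ ^ 2) • shrinkDenDeriv K k b x)

variable (K : Submodule ℝ E) {k c : ℝ} (b : E)

lemma hasFDerivAt_norm_sq_starProjection (L : Submodule ℝ E) (b x : E) :
    HasFDerivAt (fun x => ‖L.starProjection x - b‖ ^ 2)
      ((2 : ℝ) • (innerSL ℝ (L.starProjection x - b)).comp L.starProjection) x :=
  (L.starProjection.hasFDerivAt.sub_const b).norm_sq.congr_fderiv (by ext; simp)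

lemma hasFDerivAt_shrinkNum (k : ℝ) (x : E) :
    HasFDerivAt (fun x => k * ‖Kᗮ.starProjection x‖ ^ 2)
      (k • (2 : ℝ) • (innerSL ℝ (Kᗮ.starProjection x)).comp Kᗮ.starProjection) x := by
  simpa using (hasFDerivAt_norm_sq_starProjection Kᗮ 0 x).const_mul k

lemma hasFDerivAt_shrinkDen (k c : ℝ) (x : E) :
    HasFDerivAt (shrinkDen K k b c) (shrinkDenDeriv K k b x) x :=
  ((hasFDerivAt_norm_sq_starProjection K b x).add (hasFDerivAt_shrinkNum K k x)).add_const c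

lemma shrinkDen_ge (hk : 0 ≤ k) (x : E) : c ≤ shrinkDen K k b c x := by
  unfold shrinkDen
  have : 0 ≤ k * ‖Kᗮ.starProjection x‖ ^ 2 := by positivity
  nlinarith [sq_nonneg ‖K.starProjection x - b‖]

lemma hasFDerivAt_shrinkFactor (hk : 0 ≤ k) (hc : 0 < c) (x : E) :
    HasFDerivAt (shrinkFactor K k b c) (shrinkFactorDeriv K k b c x) x := by
  have hD : shrinkDen K k b c x ≠ 0 := (hc.trans_le (shrinkDen_ge K b hk x)).ne'
  refine ((hasFDerivAt_shrinkNum K k x).fun_mul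
    ((hasDerivAt_inv hD).comp_hasFDerivAt x (hasFDerivAt_shrinkDen K b k c x))).congr_fderiv ?_
  ext y
  simp only [shrinkFactorDeriv, Function.comp_apply, sub_apply, add_apply, smul_apply, smul_eq_mul]
  field_simp
  ring

lemma shrinkFactor_nonneg (hk : 0 ≤ k) (hc : 0 ≤ c) (x : E) : 0 ≤ shrinkFactor K k b c x :=
  div_nonneg (by positivity) (hc.trans (shrinkDen_ge K b hk x))

lemma shrinkFactor_le_one (hk : 0 ≤ k) (hc : 0 ≤ c) (x : E) : shrinkFactor K k b c x ≤ 1 := by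
  refine div_le_one_of_le₀ ?_ (hc.trans (shrinkDen_ge K b hk x))
  unfold shrinkDen
  nlinarith [sq_nonneg ‖K.starProjection x - b‖]

lemma shrinkRatio_nonneg (hk : 0 ≤ k) (hc : 0 ≤ c) (x : E) : 0 ≤ shrinkRatio K k b c x :=
  div_nonneg (by positivity) (hc.trans (shrinkDen_ge K b hk x))

lemma shrinkRatio_le_one (hk : 0 ≤ k) (hc : 0 ≤ c) (x : E) : shrinkRatio K k b c x ≤ 1 := by
  refine div_le_one_of_le₀ ?_ (hc.trans (shrinkDen_ge K b hk x))
  unfold shrinkDen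
  have : 0 ≤ k * ‖Kᗮ.starProjection x‖ ^ 2 := by positivity
  linarith

/-- The linear growth required by Stein's identity. The constant blows up as `c → 0`, so `c = 0` has
to be reached by a limit. -/
lemma norm_shrinkFactorDeriv_le (hk : 0 ≤ k) (hc : 0 < c) (x : E) :
    ‖shrinkFactorDeriv K k b c x‖ ≤ (4 * k + 2 + 2 * ‖b‖) / c * (1 + ‖x‖) := by
  have hD := shrinkDen_ge (c := c) K b hk x
  set D := shrinkDen K k b c x with hDdef
  have hD0 : 0 < D := hc.trans_le hD
  have hcomp : ∀ (L : Submodule ℝ E) (y : E),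
      ‖(innerSL ℝ y).comp L.starProjection‖ ≤ ‖y‖ := fun L y => by
    refine (ContinuousLinearMap.opNorm_comp_le _ _).trans ?_
    rw [innerSL_apply_norm]
    exact mul_le_of_le_one_right (norm_nonneg _) L.starProjection_norm_le
  have hx : ∀ L : Submodule ℝ E, ‖L.starProjection x‖ ≤ ‖x‖ := fun L => by
    simpa using L.starProjection.le_of_opNorm_le L.starProjection_norm_le x
  have n1 : ‖k • (2 : ℝ) • (innerSL ℝ (Kᗮ.starProjection x)).comp Kᗮ.starProjection‖
      ≤ 2 * k * ‖x‖ := by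
    rw [norm_smul, norm_smul, Real.norm_of_nonneg hk, Real.norm_of_nonneg (by norm_num)]
    nlinarith [(hcomp Kᗮ (Kᗮ.starProjection x)).trans (hx Kᗮ)]
  have n2 : ‖shrinkDenDeriv K k b x‖ ≤ 2 * (‖x‖ + ‖b‖) + 2 * k * ‖x‖ := by
    refine (norm_add_le _ _).trans (add_le_add ?_ n1)
    rw [norm_smul, Real.norm_of_nonneg (by norm_num)]
    have := (hcomp K (K.starProjection x - b)).trans (norm_sub_le _ _)
    linarith [hx K]
  have hτ0 : 0 ≤ k * ‖Kᗮ.starProjection x‖ ^ 2 := by positivity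
  have hτ : k * ‖Kᗮ.starProjection x‖ ^ 2 ≤ D := by
    rw [hDdef]; unfold shrinkDen
    nlinarith [sq_nonneg ‖K.starProjection x - b‖]
  have hnum : ‖D • (k • (2 : ℝ) • (innerSL ℝ (Kᗮ.starProjection x)).comp Kᗮ.starProjection)
      - (k * ‖Kᗮ.starProjection x‖ ^ 2) • shrinkDenDeriv K k b x‖
      ≤ D * ((4 * k + 2 + 2 * ‖b‖) * (1 + ‖x‖)) := by
    refine (norm_sub_le _ _).trans ?_
    rw [norm_smul D, norm_smul (k * _), Real.norm_of_nonneg hD0.le, Real.norm_of_nonneg hτ0]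
    have e1 := mul_le_mul_of_nonneg_left n1 hD0.le
    have e2 := mul_le_mul hτ n2 (norm_nonneg _) hD0.le
    have e3 : 2 * k * ‖x‖ + (2 * (‖x‖ + ‖b‖) + 2 * k * ‖x‖)
        ≤ (4 * k + 2 + 2 * ‖b‖) * (1 + ‖x‖) := by
      nlinarith [norm_nonneg x, norm_nonneg b, mul_nonneg (norm_nonneg x) (norm_nonneg b)]
    nlinarith [mul_le_mul_of_nonneg_left e3 hD0.le]
  unfold shrinkFactorDeriv
  rw [← hDdef, norm_smul, Real.norm_of_nonneg (by positivity)]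
  have hB : 0 ≤ (4 * k + 2 + 2 * ‖b‖) * (1 + ‖x‖) := by positivity
  calc _ ≤ (D ^ 2)⁻¹ * (D * ((4 * k + 2 + 2 * ‖b‖) * (1 + ‖x‖))) := by gcongr
    _ = (4 * k + 2 + 2 * ‖b‖) * (1 + ‖x‖) / D := by field_simp
    _ ≤ (4 * k + 2 + 2 * ‖b‖) * (1 + ‖x‖) / c := by gcongr
    _ = _ := by ring

lemma starProjection_starProjection_orthogonal (L : Submodule ℝ E) (x : E) :
    L.starProjection (Lᗮ.starProjection x) = 0 :=
  (Submodule.starProjection_apply_eq_zero_iff L).2 (Submodule.starProjection_apply_mem _ _)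

lemma starProjection_orthogonal_eq_zero {L : Submodule ℝ E} {y : E} (hy : y ∈ L) :
    Lᗮ.starProjection y = 0 :=
  (Submodule.starProjection_apply_eq_zero_iff Lᗮ).2 (by simpa using hy)

variable {b}

/-- The direction lies in `K`, so the numerator of the factor is stationary and only `‖P x - b‖²`
varies in the denominator. -/
lemma shrinkFactorDeriv_apply_self (hb : b ∈ K) (x : E) :
    shrinkFactorDeriv K k b c x (K.starProjection x - b)
      = -2 * shrinkFactor K k b c x * shrinkRatio K k b c x := by
  have hmem : K.starProjection x - b ∈ K := K.sub_mem (Submodule.starProjection_apply_mem _ _) hb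
  simp only [shrinkFactorDeriv, shrinkDenDeriv, sub_apply, add_apply, smul_apply, smul_eq_mul,
    ContinuousLinearMap.comp_apply, starProjection_orthogonal_eq_zero hmem,
    Submodule.starProjection_eq_self_iff.2 hmem, innerSL_apply_apply, inner_zero_right,
    real_inner_self_eq_norm_sq, shrinkFactor, shrinkRatio]
  simp only [div_eq_mul_inv]
  ring

/-- Along `Q x` only `τ = k‖Q x‖²` varies, and its derivative is `2τ` by homogeneity; the quotient
rule on `τ / D` gives the result. -/
lemma shrinkFactorDeriv_apply_orthogonal (hk : 0 ≤ k) (hc : 0 < c) (x : E) :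
    shrinkFactorDeriv K k b c x (Kᗮ.starProjection x)
      = 2 * (shrinkFactor K k b c x - shrinkFactor K k b c x ^ 2) := by
  have hD : shrinkDen K k b c x ≠ 0 := (hc.trans_le (shrinkDen_ge K b hk x)).ne'
  have hmem : Kᗮ.starProjection x ∈ Kᗮ := Submodule.starProjection_apply_mem _ _
  simp only [shrinkFactorDeriv, shrinkDenDeriv, sub_apply, add_apply, smul_apply, smul_eq_mul,
    ContinuousLinearMap.comp_apply, starProjection_starProjection_orthogonal,
    Submodule.starProjection_eq_self_iff.2 hmem, innerSL_apply_apply, inner_zero_right,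
    real_inner_self_eq_norm_sq, shrinkFactor]
  field_simp
  ring

lemma inner_starProjection_sub (hb : b ∈ K) (x : E) :
    ⟪x, K.starProjection x - b⟫ = ⟪K.starProjection x, K.starProjection x - b⟫ := by
  have hmem : K.starProjection x - b ∈ K := K.sub_mem (Submodule.starProjection_apply_mem _ _) hb
  rw [Submodule.inner_starProjection_left_eq_right, Submodule.starProjection_eq_self_iff.2 hmem]

lemma inner_starProjection_self (L : Submodule ℝ E) (x : E) :
    ⟪x, L.starProjection x⟫ = ‖L.starProjection x‖ ^ 2 := by
  rw [← real_inner_self_eq_norm_sq, Submodule.inner_starProjection_left_eq_right,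
    Submodule.starProjection_eq_self_iff.2 (Submodule.starProjection_apply_mem _ _)]

lemma trace_starProjection (L : Submodule ℝ E) :
    LinearMap.trace ℝ E L.starProjection = finrank ℝ L := by
  refine LinearMap.IsProj.trace (p := L) ⟨fun x => ?_, fun x hx => ?_⟩
  · exact Submodule.starProjection_apply_mem _ _
  · exact Submodule.starProjection_eq_self_iff.2 hx

/-- If `v = 0` then `u = 0` and every quotient is `0`, so the limit also holds where the denominator
degenerates. -/
lemma tendsto_div_add_of_nonneg_le {u v : ℝ} (hu : 0 ≤ u) (huv : u ≤ v) {a : ℕ → ℝ}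
    (ha : Tendsto a atTop (𝓝 0)) : Tendsto (fun n => u / (v + a n)) atTop (𝓝 (u / (v + 0))) := by
  rcases eq_or_ne v 0 with rfl | hv
  · simp [le_antisymm huv hu]
  · exact tendsto_const_nhds.div (tendsto_const_nhds.add ha) (by simpa using hv)

lemma tendsto_shrinkFactor (hk : 0 ≤ k) {a : ℕ → ℝ} (ha : Tendsto a atTop (𝓝 0)) (x : E) :
    Tendsto (fun n => shrinkFactor K k b (a n) x) atTop (𝓝 (shrinkFactor K k b 0 x)) := by
  have := tendsto_div_add_of_nonneg_le (u := k * ‖Kᗮ.starProjection x‖ ^ 2)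
    (v := ‖K.starProjection x - b‖ ^ 2 + k * ‖Kᗮ.starProjection x‖ ^ 2)
    (by positivity) (by nlinarith [sq_nonneg ‖K.starProjection x - b‖]) ha
  exact this

lemma tendsto_shrinkRatio (hk : 0 ≤ k) {a : ℕ → ℝ} (ha : Tendsto a atTop (𝓝 0)) (x : E) :
    Tendsto (fun n => shrinkRatio K k b (a n) x) atTop (𝓝 (shrinkRatio K k b 0 x)) := by
  have hτ0 : 0 ≤ k * ‖Kᗮ.starProjection x‖ ^ 2 := by positivity
  have := tendsto_div_add_of_nonneg_le (u := ‖K.starProjection x - b‖ ^ 2)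
    (v := ‖K.starProjection x - b‖ ^ 2 + k * ‖Kᗮ.starProjection x‖ ^ 2)
    (by positivity) (by linarith) ha
  exact this

lemma norm_starProjection_le (L : Submodule ℝ E) (x : E) : ‖L.starProjection x‖ ≤ ‖x‖ := by
  simpa using L.starProjection.le_of_opNorm_le L.starProjection_norm_le x

/-- The bound is free of `c`: it is the dominating function for the passage `c → 0`. -/
lemma abs_shrinkFactor_inner_le (hk : 0 ≤ k) (hc : 0 ≤ c) (x : E) :
    |shrinkFactor K k b c x * ⟪K.starProjection x, K.starProjection x - b⟫
      + 2 * shrinkFactor K k b c x * shrinkRatio K k b c x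
      - shrinkFactor K k b c x * finrank ℝ K| ≤ (3 + ‖b‖ + finrank ℝ K) * (1 + ‖x‖) ^ 2 := by
  have h0 := shrinkFactor_nonneg K b hk hc x
  have h1 := shrinkFactor_le_one K b hk hc x
  have h2 := shrinkRatio_nonneg K b hk hc x
  have h3 := shrinkRatio_le_one K b hk hc x
  have hi : |⟪K.starProjection x, K.starProjection x - b⟫| ≤ ‖x‖ * (‖x‖ + ‖b‖) := by
    refine (abs_real_inner_le_norm _ _).trans ?_
    gcongr
    · exact norm_starProjection_le K x
    · exact (norm_sub_le _ _).trans (by gcongr; exact norm_starProjection_le K x)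
  have a1 : |shrinkFactor K k b c x * ⟪K.starProjection x, K.starProjection x - b⟫|
      ≤ ‖x‖ * (‖x‖ + ‖b‖) := by
    rw [abs_mul, abs_of_nonneg h0]
    exact (mul_le_of_le_one_left (abs_nonneg _) h1).trans hi
  have a2 : 0 ≤ shrinkFactor K k b c x * shrinkRatio K k b c x := by positivity
  have a3 : shrinkFactor K k b c x * shrinkRatio K k b c x ≤ 1 := mul_le_one₀ h1 h2 h3
  have hd : (0 : ℝ) ≤ finrank ℝ K := by positivity
  have a4 : shrinkFactor K k b c x * finrank ℝ K ≤ finrank ℝ K := mul_le_of_le_one_left hd h1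
  have a5 : 0 ≤ shrinkFactor K k b c x * finrank ℝ K := by positivity
  have a6 : ‖x‖ * (‖x‖ + ‖b‖) + 2 + finrank ℝ K ≤ (3 + ‖b‖ + finrank ℝ K) * (1 + ‖x‖) ^ 2 := by
    have := norm_nonneg x
    have := norm_nonneg b
    have : 0 ≤ ‖b‖ * ‖x‖ := by positivity
    have : 0 ≤ ‖b‖ * ‖x‖ ^ 2 := by positivity
    have : 0 ≤ finrank ℝ K * ‖x‖ := by positivity
    have : 0 ≤ finrank ℝ K * ‖x‖ ^ 2 := by positivity
    nlinarith
  rw [abs_le] at a1 ⊢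
  constructor <;> linarith

lemma abs_shrinkFactor_norm_sq_le (hk : 0 ≤ k) (hc : 0 ≤ c) (x : E) :
    |(shrinkFactor K k b c x - shrinkFactor K k b c x ^ 2) *
      (‖Kᗮ.starProjection x‖ ^ 2 - 2 * (1 - 2 * shrinkFactor K k b c x) - finrank ℝ Kᗮ)|
      ≤ (3 + finrank ℝ Kᗮ) * (1 + ‖x‖) ^ 2 := by
  have h0 := shrinkFactor_nonneg K b hk hc x
  have h1 := shrinkFactor_le_one K b hk hc x
  have hd : (0 : ℝ) ≤ finrank ℝ Kᗮ := by positivity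
  have hQ := norm_starProjection_le Kᗮ x
  have hg : |shrinkFactor K k b c x - shrinkFactor K k b c x ^ 2| ≤ 1 := by
    rw [abs_le]; constructor <;> nlinarith
  have hx := norm_nonneg x
  have hQ2 : ‖Kᗮ.starProjection x‖ ^ 2 ≤ ‖x‖ ^ 2 := by gcongr
  have hQ0 : 0 ≤ ‖Kᗮ.starProjection x‖ ^ 2 := by positivity
  rw [abs_mul]
  refine (mul_le_of_le_one_left (abs_nonneg _) hg).trans ?_
  have : 0 ≤ finrank ℝ Kᗮ * ‖x‖ := by positivity
  have : 0 ≤ finrank ℝ Kᗮ * ‖x‖ ^ 2 := by positivity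
  rw [abs_le]
  constructor <;> nlinarith

/-- Trades the quadratic term of the risk for one in `‖Q x‖²`, to which Stein's identity on `Kᗮ`
applies. For `c = 0` it is an equality. -/
lemma sq_mul_le_of_shrinkFactor (hk : 0 ≤ k) (hc : 0 ≤ c) (x : E) :
    shrinkFactor K k b c x ^ 2 * ‖K.starProjection x - b‖ ^ 2
      ≤ k * ‖Kᗮ.starProjection x‖ ^ 2 *
        (shrinkFactor K k b c x - shrinkFactor K k b c x ^ 2) := by
  have hD0 := hc.trans (shrinkDen_ge K b (c := c) hk x)
  rcases hD0.eq_or_lt with h | h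
  · simp [shrinkFactor, ← h]
  unfold shrinkFactor
  have : k * ‖Kᗮ.starProjection x‖ ^ 2 / shrinkDen K k b c x
      - (k * ‖Kᗮ.starProjection x‖ ^ 2 / shrinkDen K k b c x) ^ 2
      = k * ‖Kᗮ.starProjection x‖ ^ 2 * (‖K.starProjection x - b‖ ^ 2 + c)
        / shrinkDen K k b c x ^ 2 := by
    field_simp
    unfold shrinkDen
    ring
  rw [this, div_pow, div_mul_eq_mul_div, ← mul_div_assoc]
  refine div_le_div_of_nonneg_right ?_ (sq_nonneg _)
  have : 0 ≤ (k * ‖Kᗮ.starProjection x‖ ^ 2) ^ 2 * c := by positivity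
  nlinarith

lemma shrinkRatio_le_one_sub (hk : 0 ≤ k) (hc : 0 ≤ c) (x : E) :
    shrinkFactor K k b c x * shrinkRatio K k b c x
      ≤ shrinkFactor K k b c x - shrinkFactor K k b c x ^ 2 := by
  have hD0 := hc.trans (shrinkDen_ge K b (c := c) hk x)
  have h0 := shrinkFactor_nonneg K b hk hc x
  rcases hD0.eq_or_lt with h | h
  · simp [shrinkFactor, ← h]
  have : shrinkRatio K k b c x ≤ 1 - shrinkFactor K k b c x := by
    unfold shrinkFactor shrinkRatio
    rw [le_sub_iff_add_le, ← add_div, div_le_one h]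
    unfold shrinkDen
    linarith
  nlinarith

lemma norm_shrink_sq (x : E) :
    ‖K.starProjection x - shrinkFactor K k b c x • (K.starProjection x - b)‖ ^ 2
      = ‖K.starProjection x‖ ^ 2
        - 2 * (shrinkFactor K k b c x * ⟪K.starProjection x, K.starProjection x - b⟫)
        + shrinkFactor K k b c x ^ 2 * ‖K.starProjection x - b‖ ^ 2 := by
  rw [norm_sub_sq_real, inner_smul_right, norm_smul, mul_pow, Real.norm_eq_abs, sq_abs]

/-- The bound depends on neither `b` nor `c`: far from `b` the factor is small enough to compensate
for the distance. -/
lemma norm_shrink_sq_le (hk : 0 ≤ k) (hc : 0 ≤ c) (x : E) :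
    ‖K.starProjection x - shrinkFactor K k b c x • (K.starProjection x - b)‖ ^ 2
      ≤ 2 * ‖K.starProjection x‖ ^ 2 + 2 * (k * ‖Kᗮ.starProjection x‖ ^ 2) := by
  have h0 := shrinkFactor_nonneg K b hk hc x
  have h1 := shrinkFactor_le_one K b hk hc x
  have h2 := sq_mul_le_of_shrinkFactor K (b := b) hk hc x
  have h3 : k * ‖Kᗮ.starProjection x‖ ^ 2 *
        (shrinkFactor K k b c x - shrinkFactor K k b c x ^ 2) ≤ k * ‖Kᗮ.starProjection x‖ ^ 2 :=
    mul_le_of_le_one_right (by positivity) (by nlinarith)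
  have h4 := norm_sub_le (K.starProjection x) (shrinkFactor K k b c x • (K.starProjection x - b))
  have h5 : ‖shrinkFactor K k b c x • (K.starProjection x - b)‖ ^ 2
      = shrinkFactor K k b c x ^ 2 * ‖K.starProjection x - b‖ ^ 2 := by
    rw [norm_smul, mul_pow, Real.norm_eq_abs, sq_abs]
  have h6 := pow_le_pow_left₀ (norm_nonneg _) h4 2
  nlinarith [sq_nonneg (‖K.starProjection x‖
    - ‖shrinkFactor K k b c x • (K.starProjection x - b)‖)]

/-! ### Gaussian expectations and the strict decrease of risk. -/

variable [MeasurableSpace E] [BorelSpace E]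

lemma measurable_shrinkDen : Measurable (shrinkDen K k b c) := by
  unfold shrinkDen; fun_prop

lemma measurable_shrinkFactor : Measurable (shrinkFactor K k b c) := by
  have := measurable_shrinkDen K (k := k) (c := c) (b := b)
  unfold shrinkFactor; fun_prop

lemma measurable_shrinkRatio : Measurable (shrinkRatio K k b c) := by
  have := measurable_shrinkDen K (k := k) (c := c) (b := b)
  unfold shrinkRatio; fun_prop

lemma measurable_shrinkFactorDeriv_apply (v : E) :
    Measurable fun x => shrinkFactorDeriv K k b c x v := by
  have := measurable_shrinkDen K (k := k) (c := c) (b := b)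
  simp only [shrinkFactorDeriv, shrinkDenDeriv, sub_apply, add_apply, smul_apply, smul_eq_mul,
    ContinuousLinearMap.comp_apply, innerSL_apply_apply]
  fun_prop

lemma integral_shrinkFactor_inner_of_pos (hk : 0 ≤ k) (hc : 0 < c) (hb : b ∈ K) :
    ∫ x, (shrinkFactor K k b c x * ⟪K.starProjection x, K.starProjection x - b⟫
      + 2 * shrinkFactor K k b c x * shrinkRatio K k b c x
      - shrinkFactor K k b c x * finrank ℝ K) ∂(stdGaussian E) = 0 := by
  have hC : 0 ≤ (4 * k + 2 + 2 * ‖b‖) / c := by positivity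
  have h := integral_mul_inner_affine_stdGaussian
    (hasFDerivAt_shrinkFactor K b hk hc)
    (measurable_shrinkFactorDeriv_apply K) (C := 1 + (4 * k + 2 + 2 * ‖b‖) / c)
    (fun x => by
      rw [abs_of_nonneg (shrinkFactor_nonneg K b hk hc.le x)]
      exact (shrinkFactor_le_one K b hk hc.le x).trans (by linarith))
    (fun x => (norm_shrinkFactorDeriv_le K b hk hc x).trans (by gcongr; linarith))
    K.starProjection (-b)
  rw [← h]
  congr 1 with x
  rw [← sub_eq_add_neg, shrinkFactorDeriv_apply_self K hb, inner_starProjection_sub K hb,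
    trace_starProjection]
  ring

/-- Stein's identity for the field `(φ - φ²) Q x`. The chain rule brings in `1 - 2φ`, which is at
most `1` in absolute value, so the growth bound for the derivative of `φ` carries over. -/
lemma integral_shrinkFactor_norm_sq_of_pos (hk : 0 ≤ k) (hc : 0 < c) :
    ∫ x, ((shrinkFactor K k b c x - shrinkFactor K k b c x ^ 2) *
      (‖Kᗮ.starProjection x‖ ^ 2 - 2 * (1 - 2 * shrinkFactor K k b c x) - finrank ℝ Kᗮ))
        ∂(stdGaussian E) = 0 := by
  have hC : 0 ≤ (4 * k + 2 + 2 * ‖b‖) / c := by positivity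
  have hφ0 := shrinkFactor_nonneg K b hk hc.le
  have hφ1 := shrinkFactor_le_one K b hk hc.le
  have hφm := measurable_shrinkFactor K (k := k) (c := c) (b := b)
  have h := integral_mul_inner_affine_stdGaussian
    (fun x => (hasFDerivAt_shrinkFactor K b hk hc x).sub
      ((hasFDerivAt_shrinkFactor K b hk hc x).pow 2))
    (fun v => by
      have := measurable_shrinkFactorDeriv_apply K (k := k) (c := c) (b := b) v
      simp only [sub_apply, smul_apply]
      fun_prop) (C := 1 + (4 * k + 2 + 2 * ‖b‖) / c)
    (fun x => by
      simp only [Pi.sub_apply]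
      rw [abs_le]
      constructor <;> nlinarith [hφ0 x, hφ1 x])
    (fun x => by
      have : shrinkFactorDeriv K k b c x
          - (2 • shrinkFactor K k b c x ^ (2 - 1)) • shrinkFactorDeriv K k b c x
          = (1 - 2 * shrinkFactor K k b c x) • shrinkFactorDeriv K k b c x := by
        ext; simp; ring
      rw [this, norm_smul]
      have h1 : ‖1 - 2 * shrinkFactor K k b c x‖ ≤ 1 := by
        rw [Real.norm_eq_abs, abs_le]
        constructor <;> linarith [hφ0 x, hφ1 x]
      calc _ ≤ 1 * ‖shrinkFactorDeriv K k b c x‖ := by gcongr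
        _ = ‖shrinkFactorDeriv K k b c x‖ := one_mul _
        _ ≤ _ := (norm_shrinkFactorDeriv_le K b hk hc x).trans (by gcongr; linarith))
    Kᗮ.starProjection 0
  rw [← h]
  congr 1 with x
  simp only [add_zero, sub_apply, smul_apply, Pi.sub_apply,
    shrinkFactorDeriv_apply_orthogonal K hk hc,
    inner_starProjection_self, trace_starProjection, smul_eq_mul]
  simp
  ring

/-- For `c = 0` the factor need not be differentiable where its denominator vanishes; dominated
convergence along `c = 1 / (n + 1)` covers this case. -/
lemma integral_shrinkFactor_inner (hk : 0 ≤ k) (hc : 0 ≤ c) (hb : b ∈ K) :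
    ∫ x, (shrinkFactor K k b c x * ⟪K.starProjection x, K.starProjection x - b⟫
      + 2 * shrinkFactor K k b c x * shrinkRatio K k b c x
      - shrinkFactor K k b c x * finrank ℝ K) ∂(stdGaussian E) = 0 := by
  rcases hc.eq_or_lt with rfl | hc
  swap
  · exact integral_shrinkFactor_inner_of_pos K hk hc hb
  have ha := tendsto_one_div_add_atTop_nhds_zero_nat (𝕜 := ℝ)
  refine tendsto_nhds_unique (tendsto_integral_of_dominated_convergence
    (fun x => (3 + ‖b‖ + finrank ℝ K) * (1 + ‖x‖) ^ 2)
    (F := fun (n : ℕ) x =>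
      (shrinkFactor K k b (1 / (n + 1)) x * ⟪K.starProjection x, K.starProjection x - b⟫
      + 2 * shrinkFactor K k b (1 / (n + 1)) x * shrinkRatio K k b (1 / (n + 1)) x
      - shrinkFactor K k b (1 / (n + 1)) x * finrank ℝ K))
    (fun n => ?_) ?_ (fun n => .of_forall fun x => ?_) (.of_forall fun x => ?_)) ?_
  · have := measurable_shrinkFactor K (k := k) (c := 1 / (n + 1)) (b := b)
    have := measurable_shrinkRatio K (k := k) (c := 1 / (n + 1)) (b := b)
    exact Measurable.aestronglyMeasurable (by fun_prop)
  · exact integrable_stdGaussian_of_bound (by fun_prop) (3 + ‖b‖ + finrank ℝ K) 2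
      fun x => (abs_of_nonneg (by positivity)).le
  · exact abs_shrinkFactor_inner_le K hk (by positivity) x
  · have t1 := tendsto_shrinkFactor K (b := b) hk ha x
    have t2 := tendsto_shrinkRatio K (b := b) hk ha x
    exact ((t1.mul_const _).add ((t1.const_mul 2).mul t2)).sub (t1.mul_const _)
  · simp_rw [fun n : ℕ => integral_shrinkFactor_inner_of_pos K hk
      (show (0 : ℝ) < 1 / (n + 1) by positivity) hb]
    exact tendsto_const_nhds

lemma integral_shrinkFactor_norm_sq (hk : 0 ≤ k) (hc : 0 ≤ c) :
    ∫ x, ((shrinkFactor K k b c x - shrinkFactor K k b c x ^ 2) *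
      (‖Kᗮ.starProjection x‖ ^ 2 - 2 * (1 - 2 * shrinkFactor K k b c x) - finrank ℝ Kᗮ))
        ∂(stdGaussian E) = 0 := by
  rcases hc.eq_or_lt with rfl | hc
  swap
  · exact integral_shrinkFactor_norm_sq_of_pos K hk hc
  have ha := tendsto_one_div_add_atTop_nhds_zero_nat (𝕜 := ℝ)
  refine tendsto_nhds_unique (tendsto_integral_of_dominated_convergence
    (fun x => (3 + finrank ℝ Kᗮ : ℝ) * (1 + ‖x‖) ^ 2)
    (F := fun (n : ℕ) x =>
      (shrinkFactor K k b (1 / (n + 1)) x - shrinkFactor K k b (1 / (n + 1)) x ^ 2) *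
      (‖Kᗮ.starProjection x‖ ^ 2 - 2 * (1 - 2 * shrinkFactor K k b (1 / (n + 1)) x)
        - finrank ℝ Kᗮ))
    (fun n => ?_) ?_ (fun n => .of_forall fun x => ?_) (.of_forall fun x => ?_)) ?_
  · have := measurable_shrinkFactor K (k := k) (c := 1 / (n + 1)) (b := b)
    exact Measurable.aestronglyMeasurable (by fun_prop)
  · exact integrable_stdGaussian_of_bound (by fun_prop) (3 + finrank ℝ Kᗮ) 2
      fun x => (abs_of_nonneg (by positivity)).le
  · exact abs_shrinkFactor_norm_sq_le K hk (by positivity) x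
  · have t1 := tendsto_shrinkFactor K (b := b) hk ha x
    exact (t1.sub (t1.pow 2)).mul
      ((tendsto_const_nhds.sub ((tendsto_const_nhds.sub (t1.const_mul 2)).const_mul 2)).sub
        tendsto_const_nhds)
  · simp_rw [fun n : ℕ => integral_shrinkFactor_norm_sq_of_pos K (b := b) hk
      (show (0 : ℝ) < 1 / (n + 1) by positivity)]
    exact tendsto_const_nhds

lemma ae_starProjection_ne_zero {L : Submodule ℝ E} (hL : L ≠ ⊥) :
    ∀ᵐ x ∂(stdGaussian E), L.starProjection x ≠ 0 := by
  have hac : stdGaussian E ≪ (volume : Measure E) := by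
    rw [stdGaussian_eq_withDensity]; exact withDensity_absolutelyContinuous _ _
  refine hac.ae_le ?_
  have h := Measure.addHaar_submodule (volume : Measure E) Lᗮ
    (by rwa [Ne, Submodule.orthogonal_eq_top_iff])
  refine mem_ae_iff.2 ?_
  convert h using 2
  ext x
  simp [Submodule.starProjection_apply_eq_zero_iff]

lemma integrable_norm_shrink_sq (hk : 0 ≤ k) (hc : 0 ≤ c) :
    Integrable (fun x => ‖K.starProjection x
      - shrinkFactor K k b c x • (K.starProjection x - b)‖ ^ 2) (stdGaussian E) := by
  have := measurable_shrinkFactor K (k := k) (c := c) (b := b)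
  refine integrable_stdGaussian_of_bound (by fun_prop) (2 + 2 * k) 2 fun x => ?_
  rw [abs_of_nonneg (by positivity)]
  refine (norm_shrink_sq_le K hk hc x).trans ?_
  have hp : ‖K.starProjection x‖ ≤ 1 + ‖x‖ := (norm_starProjection_le K x).trans (by linarith)
  have hq : ‖Kᗮ.starProjection x‖ ≤ 1 + ‖x‖ := (norm_starProjection_le Kᗮ x).trans (by linarith)
  calc _ ≤ 2 * (1 + ‖x‖) ^ 2 + 2 * (k * (1 + ‖x‖) ^ 2) := by gcongr
    _ = _ := by ring

lemma integrable_norm_starProjection_sq (L : Submodule ℝ E) :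
    Integrable (fun x => ‖L.starProjection x‖ ^ 2) (stdGaussian E) := by
  refine integrable_stdGaussian_of_bound (by fun_prop) 1 2 fun x => ?_
  rw [abs_of_nonneg (by positivity), one_mul]
  gcongr
  exact (norm_starProjection_le L x).trans (by linarith)

/-- Shrinking the projection `P x` of a standard Gaussian vector towards a fixed vector `b ∈ K` by
the factor `k ‖(1 - P) x‖² / (‖P x - b‖² + k ‖(1 - P) x‖² + c)` strictly decreases the mean squared
norm. -/
theorem integral_norm_shrink_sq_lt {d m : ℕ} (hd : finrank ℝ K = d) (hm : finrank ℝ Kᗮ = m)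
    (hd5 : 5 ≤ d) (hm10 : 10 ≤ m) (hc : 0 ≤ c) (hb : b ∈ K) :
    ∫ x, ‖K.starProjection x - shrinkFactor K (d / m) b c x • (K.starProjection x - b)‖ ^ 2
        ∂(stdGaussian E)
      < ∫ x, ‖K.starProjection x‖ ^ 2 ∂(stdGaussian E) := by
  have hd5' : (5 : ℝ) ≤ d := by exact_mod_cast hd5
  have hm10' : (10 : ℝ) ≤ m := by exact_mod_cast hm10
  obtain ⟨k, hkdef⟩ : ∃ k : ℝ, k = d / m := ⟨_, rfl⟩
  rw [← hkdef]
  have hk : 0 < k := by rw [hkdef]; positivity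
  have hkm : k * m = d := by rw [hkdef]; field_simp
  -- This is `4 ≤ d (1 - 2/m)`, where the dimension bounds enter; equality holds at `d = 5`, `m =
  -- 10`.
  have hk4 : 4 + d + 2 * k ≤ 2 * d := by nlinarith
  have e1 := integral_shrinkFactor_inner K hk.le hc hb
  have e2 := integral_shrinkFactor_norm_sq K (b := b) hk.le hc
  rw [hd] at e1
  rw [hm] at e2
  have hmf := measurable_shrinkFactor K (k := k) (c := c) (b := b)
  have hmr := measurable_shrinkRatio K (k := k) (c := c) (b := b)
  have i1 : Integrable (fun x =>
      (shrinkFactor K k b c x * ⟪K.starProjection x, K.starProjection x - b⟫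
      + 2 * shrinkFactor K k b c x * shrinkRatio K k b c x
      - shrinkFactor K k b c x * d)) (stdGaussian E) :=
    integrable_stdGaussian_of_bound (by fun_prop) _ 2
      fun x => by simpa [hd] using abs_shrinkFactor_inner_le K (b := b) hk.le hc x
  have i2 : Integrable (fun x => ((shrinkFactor K k b c x - shrinkFactor K k b c x ^ 2) *
      (‖Kᗮ.starProjection x‖ ^ 2 - 2 * (1 - 2 * shrinkFactor K k b c x) - m)))
      (stdGaussian E) :=
    integrable_stdGaussian_of_bound (by fun_prop) _ 2
      fun x => by simpa [hm] using abs_shrinkFactor_norm_sq_le K (b := b) hk.le hc x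
  have i3 : Integrable (fun x => 2 * d * shrinkFactor K k b c x ^ 2) (stdGaussian E) := by
    refine integrable_stdGaussian_of_bound (by fun_prop) (2 * d) 0 fun x => ?_
    have h0 := shrinkFactor_nonneg K b hk.le hc x
    have h1 := shrinkFactor_le_one K b hk.le hc x
    rw [abs_of_nonneg (by positivity), pow_zero, mul_one]
    exact mul_le_of_le_one_right (by positivity) (pow_le_one₀ h0 h1)
  have i4 := integrable_norm_shrink_sq K (b := b) hk.le hc
  have i5 := integrable_norm_starProjection_sq K
  -- The two bracketed Stein terms integrate to zero, so only the gain `2dφ²` survives.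
  have hpt : ∀ x, ‖K.starProjection x - shrinkFactor K k b c x • (K.starProjection x - b)‖ ^ 2
      ≤ ‖K.starProjection x‖ ^ 2
        - 2 * (shrinkFactor K k b c x * ⟪K.starProjection x, K.starProjection x - b⟫
          + 2 * shrinkFactor K k b c x * shrinkRatio K k b c x
          - shrinkFactor K k b c x * d)
        + k * ((shrinkFactor K k b c x - shrinkFactor K k b c x ^ 2) *
      (‖Kᗮ.starProjection x‖ ^ 2 - 2 * (1 - 2 * shrinkFactor K k b c x) - m))
        - 2 * d * shrinkFactor K k b c x ^ 2 := by
    intro x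
    rw [norm_shrink_sq]
    have h0 := shrinkFactor_nonneg K b hk.le hc x
    have h1 := shrinkFactor_le_one K b hk.le hc x
    have h2 := sq_mul_le_of_shrinkFactor K (b := b) hk.le hc x
    have h3 := shrinkRatio_le_one_sub K (b := b) hk.le hc x
    have h4 : 0 ≤ (shrinkFactor K k b c x - shrinkFactor K k b c x ^ 2) := by nlinarith
    have h5 : 0 ≤ k * shrinkFactor K k b c x := by positivity
    have h6 := mul_le_mul_of_nonneg_left (show 4 + d + 2 * k * (1 - 2 * shrinkFactor K k b c x)
      ≤ 2 * d by nlinarith) h4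
    nlinarith
  -- Strictness, even when `hk4` is an equality: `φ > 0` whenever `Q x ≠ 0`, hence almost surely.
  have hpos : 0 < ∫ x, 2 * d * shrinkFactor K k b c x ^ 2 ∂(stdGaussian E) := by
    rw [integral_pos_iff_support_of_nonneg (fun x => by positivity) i3]
    have hne : Kᗮ ≠ ⊥ := fun h => by rw [h, finrank_bot] at hm; omega
    have hae : ∀ᵐ x ∂(stdGaussian E),
        x ∈ Function.support fun x => 2 * d * shrinkFactor K k b c x ^ 2 := by
      filter_upwards [ae_starProjection_ne_zero hne] with x hx
      have hx' := norm_pos_iff.2 hx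
      have : 0 < shrinkFactor K k b c x := by
        unfold shrinkFactor shrinkDen
        positivity
      rw [Function.mem_support]
      positivity
    have h1 := (prob_compl_eq_zero_iff (measurableSet_support (by fun_prop))).1 (mem_ae_iff.1 hae)
    exact h1 ▸ one_pos
  have hle := integral_mono i4 (((i5.sub (i1.const_mul 2)).add (i2.const_mul k)).sub i3) hpt
  rw [integral_sub' ((i5.sub (i1.const_mul 2)).add (i2.const_mul k)) i3,
    integral_add' (i5.sub (i1.const_mul 2)) (i2.const_mul k),
    integral_sub' i5 (i1.const_mul 2), integral_const_mul 2, integral_const_mul k, e1, e2] at hle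
  linarith

end Shrinkage

/-! ### Least squares as orthogonal projection, and the Gaussian linear model. -/

section LinearModel

open Module
open scoped RealInnerProductSpace MatrixOrder

namespace DataEnriched

lemma norm_sq_toEuclideanLin {n d : ℕ} (X : Matrix (Fin n) (Fin d) ℝ)
    (v : EuclideanSpace ℝ (Fin d)) :
    ‖Matrix.toEuclideanLin X v‖ ^ 2 = quadForm (Xᵀ * X) v := by
  rw [← real_inner_self_eq_norm_sq, EuclideanSpace.inner_eq_star_dotProduct, quadForm,
    ← Matrix.mulVec_mulVec, Matrix.dotProduct_mulVec, Matrix.vecMul_transpose]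
  simp [Matrix.toLpLin_apply]

lemma quadForm_smul {d : ℕ} (a : ℝ) (M : Matrix (Fin d) (Fin d) ℝ)
    (v : EuclideanSpace ℝ (Fin d)) : quadForm (a • M) v = a * quadForm M v := by
  simp [quadForm, Matrix.smul_mulVec]

lemma isUnit_of_rank_eq {d : ℕ} {M : Matrix (Fin d) (Fin d) ℝ} (h : M.rank = d) : IsUnit M := by
  rw [← Matrix.linearIndependent_cols_iff_isUnit,
    linearIndependent_iff_card_eq_finrank_span, Set.finrank, ← Matrix.rank_eq_finrank_span_cols]
  simp [h]

variable {n d : ℕ} {X : Matrix (Fin n) (Fin d) ℝ}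

lemma toEuclideanLin_injective (hX : IsUnit (Xᵀ * X)) :
    Function.Injective (Matrix.toEuclideanLin X) := by
  rw [← LinearMap.ker_eq_bot, LinearMap.ker_eq_bot']
  intro v hv
  have h : X *ᵥ v.ofLp = 0 := by
    have := congrArg WithLp.ofLp hv
    simpa [Matrix.toLpLin_apply] using this
  have h2 : (Xᵀ * X) *ᵥ v.ofLp = 0 := by rw [← Matrix.mulVec_mulVec, h, Matrix.mulVec_zero]
  have h3 := Matrix.mulVec_injective_of_isUnit hX (h2.trans (Matrix.mulVec_zero _).symm)
  exact (WithLp.ofLp_eq_zero 2).1 h3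

lemma finrank_range_toEuclideanLin (hX : IsUnit (Xᵀ * X)) :
    finrank ℝ (LinearMap.range (Matrix.toEuclideanLin X)) = d := by
  rw [LinearMap.finrank_range_of_inj (toEuclideanLin_injective hX)]
  simp

/-- The normal equations say that the residual is orthogonal to the range of `X`. -/
lemma toEuclideanLin_ols (hX : IsUnit (Xᵀ * X)) (y : EuclideanSpace ℝ (Fin n)) :
    Matrix.toEuclideanLin X (ols X y)
      = (LinearMap.range (Matrix.toEuclideanLin X)).starProjection y := by
  refine (Submodule.eq_starProjection_of_mem_of_inner_eq_zero (LinearMap.mem_range_self _ _)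
    ?_).symm
  rintro _ ⟨v, rfl⟩
  have hdet := (Matrix.isUnit_iff_isUnit_det _).1 hX
  have key : Xᵀ *ᵥ (y - Matrix.toEuclideanLin X (ols X y)).ofLp = 0 := by
    simp only [ols, Matrix.toLpLin_apply, WithLp.ofLp_sub, Matrix.mulVec_sub, Matrix.mulVec_mulVec]
    rw [← Matrix.mul_assoc Xᵀ X, ← Matrix.mul_assoc (Xᵀ * X), Matrix.mul_nonsing_inv _ hdet,
      Matrix.one_mul, sub_self]
  rw [EuclideanSpace.inner_eq_star_dotProduct, star_trivial, Matrix.toLpLin_apply,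
    dotProduct_comm, Matrix.dotProduct_mulVec, ← Matrix.mulVec_transpose, key, zero_dotProduct]

lemma linearModel_eq_map (X : Matrix (Fin n) (Fin d) ℝ) (b : EuclideanSpace ℝ (Fin d)) {σ : ℝ}
    (hσ : 0 ≤ σ) :
    linearModel X b σ = (stdGaussian (EuclideanSpace ℝ (Fin n))).map
      (fun x => Matrix.toEuclideanLin X b + σ • x) := by
  have hsq : CFC.sqrt (σ ^ 2 • (1 : Matrix (Fin n) (Fin n) ℝ)) = σ • (1 : Matrix (Fin n) (Fin n) ℝ) := by
    refine CFC.sqrt_unique ?_ ?_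
    · simp [smul_smul, sq]
    · exact (Matrix.PosSemidef.one.smul hσ).nonneg
  unfold linearModel multivariateGaussian
  rw [hsq]
  congr 1 with x i
  simp

instance isProbabilityMeasure_linearModel (X : Matrix (Fin n) (Fin d) ℝ)
    (b : EuclideanSpace ℝ (Fin d)) (σ : ℝ) : IsProbabilityMeasure (linearModel X b σ) := by
  unfold linearModel; infer_instance

lemma continuous_ols (X : Matrix (Fin n) (Fin d) ℝ) : Continuous (ols X) :=
  LinearMap.continuous_of_finiteDimensional _

lemma continuous_toEuclideanLin (X : Matrix (Fin n) (Fin d) ℝ) :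
    Continuous (Matrix.toEuclideanLin X) :=
  LinearMap.continuous_of_finiteDimensional _

lemma continuous_residVar (X : Matrix (Fin n) (Fin d) ℝ) : Continuous (residVar X) := by
  have := continuous_ols X
  have := continuous_toEuclideanLin X
  unfold residVar
  fun_prop

lemma continuous_quadForm (M : Matrix (Fin d) (Fin d) ℝ) : Continuous (quadForm M) := by
  unfold quadForm dotProduct Matrix.mulVec dotProduct
  fun_prop

lemma residVar_nonneg (hdn : d ≤ n) (X : Matrix (Fin n) (Fin d) ℝ)
    (y : EuclideanSpace ℝ (Fin n)) : 0 ≤ residVar X y :=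
  div_nonneg (sq_nonneg _) (sub_nonneg.2 (by exact_mod_cast hdn))

lemma measurable_enriched {N : ℕ} (Sig : Matrix (Fin d) (Fin d) ℝ)
    (XS : Matrix (Fin n) (Fin d) ℝ) (XB : Matrix (Fin N) (Fin d) ℝ) {h : ℝ → ℝ}
    (hh : Measurable h) :
    Measurable fun y : EuclideanSpace ℝ (Fin n) × EuclideanSpace ℝ (Fin N) =>
      enriched Sig XS XB h y.1 y.2 := by
  have := (continuous_ols XS).measurable
  have := (continuous_ols XB).measurable
  have := (continuous_residVar XS).measurable
  have := (continuous_residVar XB).measurable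
  have := (continuous_quadForm Sig).measurable
  unfold enriched plugInWeight
  fun_prop

end DataEnriched

end LinearModel

/-! ### Reduction of the enriched estimator to the shrinkage problem. -/

section Enriched

open Module
open scoped RealInnerProductSpace

namespace DataEnriched

variable {n N d r : ℕ} {Sig : Matrix (Fin d) (Fin d) ℝ} {XS : Matrix (Fin n) (Fin d) ℝ}
  {XB : Matrix (Fin N) (Fin d) ℝ} {XT : Matrix (Fin r) (Fin d) ℝ} {h : ℝ → ℝ}

lemma quadForm_eq_norm_sq_div (hn : 0 < n) (hXS : XSᵀ * XS = (n : ℝ) • Sig)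
    (v : EuclideanSpace ℝ (Fin d)) :
    quadForm Sig v = ‖Matrix.toEuclideanLin XS v‖ ^ 2 / n := by
  have : (n : ℝ) ≠ 0 := by exact_mod_cast hn.ne'
  rw [norm_sq_toEuclideanLin, hXS, quadForm_smul]
  field_simp

lemma norm_sq_target_eq (hn : 0 < n) (hXS : XSᵀ * XS = (n : ℝ) • Sig) (hXT : XTᵀ * XT = Sig)
    (v β : EuclideanSpace ℝ (Fin d)) :
    ‖Matrix.toEuclideanLin XT v - Matrix.toEuclideanLin XT β‖ ^ 2
      = ‖Matrix.toEuclideanLin XS v - Matrix.toEuclideanLin XS β‖ ^ 2 / n := by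
  rw [← map_sub, ← map_sub, norm_sq_toEuclideanLin, hXT, quadForm_eq_norm_sq_div hn hXS]

lemma toEuclideanLin_enriched_sub (yS : EuclideanSpace ℝ (Fin n)) (yB : EuclideanSpace ℝ (Fin N))
    (β : EuclideanSpace ℝ (Fin d)) :
    Matrix.toEuclideanLin XS (enriched Sig XS XB h yS yB) - Matrix.toEuclideanLin XS β
      = (Matrix.toEuclideanLin XS (ols XS yS) - Matrix.toEuclideanLin XS β)
        - (1 - plugInWeight Sig XS XB h yS yB) •
          (Matrix.toEuclideanLin XS (ols XS yS) - Matrix.toEuclideanLin XS (ols XB yB)) := by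
  simp only [enriched, map_add, map_smul]
  module

lemma sq_one_sub_div_mul_le {q u t : ℝ} (hq : 0 ≤ q) (hqu : q ≤ u) (ht : 0 ≤ t) :
    (1 - u / (u + t)) ^ 2 * q ≤ t := by
  rcases (add_nonneg (hq.trans hqu) ht).eq_or_lt with h0 | h0
  · have : q = 0 := by linarith
    simpa [this] using ht
  · have h1 : 1 - u / (u + t) = t / (u + t) := by field_simp; ring
    rw [h1, div_pow, div_mul_eq_mul_div, div_le_iff₀ (by positivity), sq, mul_assoc]
    refine mul_le_mul_of_nonneg_left ?_ ht
    nlinarith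

/-- The bound does not involve `yB`, so the enriched loss is integrable under any law of the big
sample. -/
lemma norm_sq_enriched_sub_le (hn : 0 < n) (hdn : d ≤ n) (hXS : XSᵀ * XS = (n : ℝ) • Sig)
    (yS : EuclideanSpace ℝ (Fin n)) {yB : EuclideanSpace ℝ (Fin N)} (hh : 0 ≤ h (residVar XB yB))
    (β : EuclideanSpace ℝ (Fin d)) :
    ‖Matrix.toEuclideanLin XS (enriched Sig XS XB h yS yB) - Matrix.toEuclideanLin XS β‖ ^ 2
      ≤ 2 * ‖Matrix.toEuclideanLin XS (ols XS yS) - Matrix.toEuclideanLin XS β‖ ^ 2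
        + 2 * (d * residVar XS yS) := by
  have hn' : (0 : ℝ) < n := by exact_mod_cast hn
  have hs := residVar_nonneg hdn XS yS
  have hq : quadForm Sig (ols XB yB - ols XS yS)
      = ‖Matrix.toEuclideanLin XS (ols XS yS) - Matrix.toEuclideanLin XS (ols XB yB)‖ ^ 2 / n := by
    rw [quadForm_eq_norm_sq_div hn hXS, map_sub, norm_sub_rev]
  have hw := sq_one_sub_div_mul_le (q := quadForm Sig (ols XB yB - ols XS yS))
    (u := quadForm Sig (ols XB yB - ols XS yS) + h (residVar XB yB))
    (t := d * residVar XS yS / n) (by rw [hq]; positivity) (by linarith) (by positivity)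
  rw [toEuclideanLin_enriched_sub]
  set A := Matrix.toEuclideanLin XS (ols XS yS) - Matrix.toEuclideanLin XS β
  set B := Matrix.toEuclideanLin XS (ols XS yS) - Matrix.toEuclideanLin XS (ols XB yB)
  set ω := plugInWeight Sig XS XB h yS yB with hω
  have hB : ‖(1 - ω) • B‖ ^ 2 ≤ d * residVar XS yS := by
    change (1 - ω) ^ 2 * _ ≤ _ at hw
    rw [hq, ← mul_div_assoc, div_le_div_iff_of_pos_right hn'] at hw
    rwa [norm_smul, mul_pow, Real.norm_eq_abs, sq_abs]
  have h6 := pow_le_pow_left₀ (norm_nonneg _) (norm_sub_le A ((1 - ω) • B)) 2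
  nlinarith [sq_nonneg (‖A‖ - ‖(1 - ω) • B‖)]

lemma ols_fit_sub (hX : IsUnit (XSᵀ * XS)) (β : EuclideanSpace ℝ (Fin d)) (σ : ℝ)
    (x : EuclideanSpace ℝ (Fin n)) :
    Matrix.toEuclideanLin XS (ols XS (Matrix.toEuclideanLin XS β + σ • x))
        - Matrix.toEuclideanLin XS β
      = σ • (LinearMap.range (Matrix.toEuclideanLin XS)).starProjection x := by
  rw [toEuclideanLin_ols hX, map_add, map_smul,
    Submodule.starProjection_eq_self_iff.2 (LinearMap.mem_range_self _ β), add_sub_cancel_left]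

lemma residVar_eq (hX : IsUnit (XSᵀ * XS)) (β : EuclideanSpace ℝ (Fin d)) (σ : ℝ)
    (x : EuclideanSpace ℝ (Fin n)) :
    residVar XS (Matrix.toEuclideanLin XS β + σ • x)
      = σ ^ 2 * ‖(LinearMap.range (Matrix.toEuclideanLin XS))ᗮ.starProjection x‖ ^ 2
        / ((n : ℝ) - d) := by
  have h1 := ols_fit_sub hX β σ x
  have h2 : Matrix.toEuclideanLin XS β + σ • x - Matrix.toEuclideanLin XS
      (ols XS (Matrix.toEuclideanLin XS β + σ • x))
      = σ • (LinearMap.range (Matrix.toEuclideanLin XS))ᗮ.starProjection x := by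
    rw [Submodule.starProjection_orthogonal_val, smul_sub, ← h1]
    abel
  rw [residVar, h2, norm_smul, mul_pow, Real.norm_eq_abs, sq_abs]

/-- Multiplying numerator and denominator by `n / σ²` matches the two fractions. The condition `hx`
is essential: with vanishing denominators the left side would be `1` and the right side `0`. -/
lemma one_sub_plugInWeight_eq (hd : 0 < d) (hdn : d < n) (hXS : XSᵀ * XS = (n : ℝ) • Sig)
    (hX : IsUnit (XSᵀ * XS)) (β : EuclideanSpace ℝ (Fin d)) {σ : ℝ} (hσ : 0 < σ)
    {x : EuclideanSpace ℝ (Fin n)} {yB : EuclideanSpace ℝ (Fin N)} (hh : 0 ≤ h (residVar XB yB))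
    (hx : (LinearMap.range (Matrix.toEuclideanLin XS))ᗮ.starProjection x ≠ 0) :
    1 - plugInWeight Sig XS XB h (Matrix.toEuclideanLin XS β + σ • x) yB
      = shrinkFactor (LinearMap.range (Matrix.toEuclideanLin XS)) (d / (n - d : ℕ))
        (σ⁻¹ • (Matrix.toEuclideanLin XS (ols XB yB) - Matrix.toEuclideanLin XS β))
        (n * h (residVar XB yB) / σ ^ 2) x := by
  have hn' : (0 : ℝ) < n := by exact_mod_cast hd.trans hdn
  have hd' : (0 : ℝ) < d := by exact_mod_cast hd
  have hm : (0 : ℝ) < (n : ℝ) - d := sub_pos.2 (by exact_mod_cast hdn)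
  have hx' := norm_pos_iff.2 hx
  have hq : quadForm Sig (ols XB yB - ols XS (Matrix.toEuclideanLin XS β + σ • x))
      = σ ^ 2 * ‖(LinearMap.range (Matrix.toEuclideanLin XS)).starProjection x
        - σ⁻¹ • (Matrix.toEuclideanLin XS (ols XB yB) - Matrix.toEuclideanLin XS β)‖ ^ 2 / n := by
    rw [quadForm_eq_norm_sq_div (hd.trans hdn) hXS, map_sub, norm_sub_rev]
    have h1 := ols_fit_sub hX β σ x
    have : Matrix.toEuclideanLin XS (ols XS (Matrix.toEuclideanLin XS β + σ • x))
        - Matrix.toEuclideanLin XS (ols XB yB)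
        = σ • ((LinearMap.range (Matrix.toEuclideanLin XS)).starProjection x
        - σ⁻¹ • (Matrix.toEuclideanLin XS (ols XB yB) - Matrix.toEuclideanLin XS β)) := by
      rw [smul_sub, ← h1, smul_smul, mul_inv_cancel₀ hσ.ne', one_smul]
      abel
    rw [this, norm_smul, mul_pow, Real.norm_eq_abs, sq_abs]
  unfold plugInWeight shrinkFactor shrinkDen
  rw [hq, residVar_eq hX, Nat.cast_sub hdn.le]
  generalize ‖(LinearMap.range (Matrix.toEuclideanLin XS)).starProjection x
        - σ⁻¹ • (Matrix.toEuclideanLin XS (ols XB yB) - Matrix.toEuclideanLin XS β)‖ = p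
  generalize ‖(LinearMap.range (Matrix.toEuclideanLin XS))ᗮ.starProjection x‖ = q at hx'
  generalize h (residVar XB yB) = a at hh
  generalize (n : ℝ) - d = m at hm
  have hden : (σ ^ 2 * p ^ 2 / n + a + d * (σ ^ 2 * q ^ 2 / m) / n) ≠ 0 := by positivity
  have hden' : p ^ 2 + d / m * q ^ 2 + n * a / σ ^ 2 ≠ 0 := by positivity
  rw [one_sub_div hden, div_eq_div_iff hden hden']
  field_simp
  ring

lemma enriched_fit_sub (hd : 0 < d) (hdn : d < n) (hXS : XSᵀ * XS = (n : ℝ) • Sig)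
    (hX : IsUnit (XSᵀ * XS)) (β : EuclideanSpace ℝ (Fin d)) {σ : ℝ} (hσ : 0 < σ)
    {x : EuclideanSpace ℝ (Fin n)} {yB : EuclideanSpace ℝ (Fin N)} (hh : 0 ≤ h (residVar XB yB))
    (hx : (LinearMap.range (Matrix.toEuclideanLin XS))ᗮ.starProjection x ≠ 0) :
    Matrix.toEuclideanLin XS (enriched Sig XS XB h (Matrix.toEuclideanLin XS β + σ • x) yB)
        - Matrix.toEuclideanLin XS β
      = σ • ((LinearMap.range (Matrix.toEuclideanLin XS)).starProjection x
        - shrinkFactor (LinearMap.range (Matrix.toEuclideanLin XS)) (d / (n - d : ℕ))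
          (σ⁻¹ • (Matrix.toEuclideanLin XS (ols XB yB) - Matrix.toEuclideanLin XS β))
          (n * h (residVar XB yB) / σ ^ 2) x •
          ((LinearMap.range (Matrix.toEuclideanLin XS)).starProjection x
            - σ⁻¹ • (Matrix.toEuclideanLin XS (ols XB yB) - Matrix.toEuclideanLin XS β))) := by
  rw [toEuclideanLin_enriched_sub, one_sub_plugInWeight_eq hd hdn hXS hX β hσ hh hx]
  generalize shrinkFactor (LinearMap.range (Matrix.toEuclideanLin XS)) _ _ _ _ = φ
  have h1 := ols_fit_sub hX β σ x
  rw [smul_sub σ, smul_comm σ φ, smul_sub σ _ (σ⁻¹ • _), ← h1, smul_smul σ σ⁻¹,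
    mul_inv_cancel₀ hσ.ne', one_smul, sub_sub_sub_cancel_right]

lemma integrable_norm_sq_ols_sub (hX : IsUnit (XSᵀ * XS)) (β : EuclideanSpace ℝ (Fin d)) {σ : ℝ}
    (hσ : 0 ≤ σ) :
    Integrable (fun y => ‖Matrix.toEuclideanLin XS (ols XS y) - Matrix.toEuclideanLin XS β‖ ^ 2)
      (linearModel XS β σ) := by
  have := (continuous_toEuclideanLin XS).measurable
  have := (continuous_ols XS).measurable
  rw [linearModel_eq_map XS β hσ, integrable_map_measure
    (Measurable.aestronglyMeasurable (by fun_prop)) (by fun_prop)]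
  refine ((integrable_norm_starProjection_sq
    (LinearMap.range (Matrix.toEuclideanLin XS))).const_mul (σ ^ 2)).congr (.of_forall fun x => ?_)
  simp only [Function.comp_apply]
  rw [ols_fit_sub hX, norm_smul, mul_pow, Real.norm_eq_abs, sq_abs]

lemma integrable_residVar (hX : IsUnit (XSᵀ * XS)) (β : EuclideanSpace ℝ (Fin d)) {σ : ℝ}
    (hσ : 0 ≤ σ) : Integrable (residVar XS) (linearModel XS β σ) := by
  rw [linearModel_eq_map XS β hσ, integrable_map_measure
    (continuous_residVar XS).aestronglyMeasurable (by fun_prop)]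
  refine (((integrable_norm_starProjection_sq
    (LinearMap.range (Matrix.toEuclideanLin XS))ᗮ).const_mul (σ ^ 2)).div_const
      ((n : ℝ) - d)).congr (.of_forall fun x => ?_)
  simp only [Function.comp_apply]
  rw [residVar_eq hX]

lemma integral_norm_sq_enriched_sub_lt (hd : 5 ≤ d) (hm : d + 10 ≤ n)
    (hXS : XSᵀ * XS = (n : ℝ) • Sig) (hX : IsUnit (XSᵀ * XS)) (β : EuclideanSpace ℝ (Fin d))
    {σ : ℝ} (hσ : 0 < σ) (hhm : Measurable h) {yB : EuclideanSpace ℝ (Fin N)}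
    (hh : 0 ≤ h (residVar XB yB)) :
    ∫ y, ‖Matrix.toEuclideanLin XS (enriched Sig XS XB h y yB) - Matrix.toEuclideanLin XS β‖ ^ 2
        ∂(linearModel XS β σ)
      < ∫ y, ‖Matrix.toEuclideanLin XS (ols XS y) - Matrix.toEuclideanLin XS β‖ ^ 2
        ∂(linearModel XS β σ) := by
  have := (continuous_toEuclideanLin XS).measurable
  have := (continuous_ols XS).measurable
  have : Measurable fun y => enriched Sig XS XB h y yB := by
    have hp : Measurable fun y : EuclideanSpace ℝ (Fin n) => (y, yB) := by fun_prop
    have hc := (measurable_enriched Sig XS XB hhm).comp hp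
    simpa only [Function.comp_def] using hc
  have hK := finrank_range_toEuclideanLin hX
  have hK' : finrank ℝ (LinearMap.range (Matrix.toEuclideanLin XS))ᗮ = n - d := by
    have := Submodule.finrank_add_finrank_orthogonal (LinearMap.range (Matrix.toEuclideanLin XS))
    rw [hK, finrank_euclideanSpace_fin] at this
    omega
  have hne : (LinearMap.range (Matrix.toEuclideanLin XS))ᗮ ≠ ⊥ := fun h0 => by
    rw [h0, finrank_bot] at hK'; omega
  have hmem : σ⁻¹ • (Matrix.toEuclideanLin XS (ols XB yB) - Matrix.toEuclideanLin XS β)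
      ∈ LinearMap.range (Matrix.toEuclideanLin XS) :=
    Submodule.smul_mem _ _ (Submodule.sub_mem _ (LinearMap.mem_range_self _ _)
      (LinearMap.mem_range_self _ _))
  have hc : 0 ≤ n * h (residVar XB yB) / σ ^ 2 := by positivity
  have key := integral_norm_shrink_sq_lt (LinearMap.range (Matrix.toEuclideanLin XS)) hK hK' hd
    (by omega) hc hmem
  rw [linearModel_eq_map XS β hσ.le, integral_map (by fun_prop)
    (Measurable.aestronglyMeasurable (by fun_prop)), integral_map (by fun_prop)
    (Measurable.aestronglyMeasurable (by fun_prop))]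
  have hsq : (0 : ℝ) < σ ^ 2 := by positivity
  have key' := mul_lt_mul_of_pos_left key hsq
  rw [← integral_const_mul, ← integral_const_mul] at key'
  convert! key' using 1
  · refine integral_congr_ae ?_
    filter_upwards [ae_starProjection_ne_zero hne] with x hx
    rw [enriched_fit_sub (by omega) (by omega) hXS hX β hσ hh hx, norm_smul, mul_pow,
      Real.norm_eq_abs, sq_abs]
  · refine integral_congr_ae (.of_forall fun x => ?_)
    simp only
    rw [ols_fit_sub hX, norm_smul, mul_pow, Real.norm_eq_abs, sq_abs]

/-- The data-enriched estimator dominates least squares whatever the law `μB` of the big sample,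
as long as the big sample is independent of the small one. -/
theorem enriched_dominates_ols (hd : 5 ≤ d) (hm : d + 10 ≤ n)
    (hXS : XSᵀ * XS = (n : ℝ) • Sig) (hXT : XTᵀ * XT = Sig) (hX : IsUnit (XSᵀ * XS))
    (β : EuclideanSpace ℝ (Fin d)) {σ : ℝ} (hσ : 0 < σ) (hhm : Measurable h)
    (hh : ∀ yB, 0 ≤ h (residVar XB yB))
    (μB : Measure (EuclideanSpace ℝ (Fin N))) [IsProbabilityMeasure μB] :
    Integrable (fun y => ‖Matrix.toEuclideanLin XT (enriched Sig XS XB h y.1 y.2)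
        - Matrix.toEuclideanLin XT β‖ ^ 2) ((linearModel XS β σ).prod μB) ∧
    Integrable (fun y => ‖Matrix.toEuclideanLin XT (ols XS y.1)
        - Matrix.toEuclideanLin XT β‖ ^ 2) ((linearModel XS β σ).prod μB) ∧
    ∫ y, ‖Matrix.toEuclideanLin XT (enriched Sig XS XB h y.1 y.2)
        - Matrix.toEuclideanLin XT β‖ ^ 2 ∂((linearModel XS β σ).prod μB)
      < ∫ y, ‖Matrix.toEuclideanLin XT (ols XS y.1)
        - Matrix.toEuclideanLin XT β‖ ^ 2 ∂((linearModel XS β σ).prod μB) := by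
  have hn : 0 < n := by omega
  have hn' : (0 : ℝ) < n := by exact_mod_cast hn
  have hmX := (continuous_toEuclideanLin XS).measurable
  have hme := measurable_enriched Sig XS XB hhm
  simp_rw [norm_sq_target_eq hn hXS hXT]
  have iO := (integrable_norm_sq_ols_sub hX β hσ.le).comp_fst μB
  have iR := (integrable_residVar hX β hσ.le).comp_fst μB
  have iE : Integrable (fun y => ‖Matrix.toEuclideanLin XS (enriched Sig XS XB h y.1 y.2)
      - Matrix.toEuclideanLin XS β‖ ^ 2) ((linearModel XS β σ).prod μB) := by
    refine ((iO.const_mul 2).add ((iR.const_mul d).const_mul 2)).mono'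
      (Measurable.aestronglyMeasurable (by fun_prop)) (.of_forall fun y => ?_)
    rw [Real.norm_of_nonneg (by positivity)]
    exact norm_sq_enriched_sub_le hn (by omega) hXS y.1 (hh y.2) β
  refine ⟨iE.div_const _, iO.div_const _, ?_⟩
  -- Fubini with `yB` outermost: for fixed `yB` the target `b` and the constant `c` of the shrinkage
  -- problem are deterministic.
  rw [integral_div, integral_div, div_lt_div_iff_of_pos_right hn', integral_prod_symm _ iE,
    integral_fun_fst (f := fun y => ‖Matrix.toEuclideanLin XS (ols XS y)
      - Matrix.toEuclideanLin XS β‖ ^ 2)]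
  have hlt := fun yB => integral_norm_sq_enriched_sub_lt hd hm hXS hX β hσ hhm (hh yB)
  set c := ∫ y, ‖Matrix.toEuclideanLin XS (ols XS y) - Matrix.toEuclideanLin XS β‖ ^ 2
    ∂(linearModel XS β σ)
  have iI := iE.integral_prod_right
  have hpos : 0 < ∫ yB, (c - ∫ y, ‖Matrix.toEuclideanLin XS (enriched Sig XS XB h y yB)
      - Matrix.toEuclideanLin XS β‖ ^ 2 ∂(linearModel XS β σ)) ∂μB := by
    rw [integral_pos_iff_support_of_nonneg (fun yB => (sub_pos.2 (hlt yB)).le)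
      ((integrable_const c).sub iI),
      Set.eq_univ_of_forall (fun yB => Function.mem_support.2 (sub_pos.2 (hlt yB)).ne')]
    simp
  rw [integral_sub (integrable_const c) iI] at hpos
  simpa using hpos

end DataEnriched

end Enriched

/-! ### Domination and inadmissibility. -/

theorem theorem4 {n N d r : ℕ}
    (Sig VB : Matrix (Fin d) (Fin d) ℝ)
    (XS : Matrix (Fin n) (Fin d) ℝ) (XB : Matrix (Fin N) (Fin d) ℝ)
    (XT : Matrix (Fin r) (Fin d) ℝ)
    (hXS : XSᵀ * XS = (n : ℝ) • Sig) (hXB : XBᵀ * XB = VB) (hXT : XTᵀ * XT = Sig)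
    (hSig : Sig.rank = d) (hVB : VB.rank = d)
    (hd : 5 ≤ d) (hm : d + 10 ≤ n) :
    (∀ {Ω : Type*} [MeasurableSpace Ω] (P : Measure Ω) [IsProbabilityMeasure P]
        (β γ : EuclideanSpace ℝ (Fin d)) (σS σB : ℝ) (_ : 0 < σS) (_ : 0 ≤ σB)
        (YS : Ω → EuclideanSpace ℝ (Fin n)) (YB : Ω → EuclideanSpace ℝ (Fin N))
        (_ : HasLaw YS (DataEnriched.linearModel XS β σS) P)
        (_ : HasLaw YB (DataEnriched.linearModel XB (β + γ) σB) P)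
        (_ : IndepFun YS YB P)
        (h : ℝ → ℝ) (_ : Measurable h) (_ : ∀ x, 0 ≤ x → 0 ≤ h x)
        (_ : Integrable (fun w => h (DataEnriched.residVar XB (YB w))) P),
      Integrable (fun w => ‖Matrix.toEuclideanLin XT
          (DataEnriched.enriched Sig XS XB h (YS w) (YB w)) - Matrix.toEuclideanLin XT β‖ ^ 2) P ∧
      Integrable (fun w => ‖Matrix.toEuclideanLin XT
          (DataEnriched.ols XS (YS w)) - Matrix.toEuclideanLin XT β‖ ^ 2) P ∧
      ∫ w, ‖Matrix.toEuclideanLin XT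
          (DataEnriched.enriched Sig XS XB h (YS w) (YB w)) - Matrix.toEuclideanLin XT β‖ ^ 2 ∂P <
        ∫ w, ‖Matrix.toEuclideanLin XT
          (DataEnriched.ols XS (YS w)) - Matrix.toEuclideanLin XT β‖ ^ 2 ∂P) ∧
    DataEnriched.Inadmissible (DataEnriched.jointModel XS XB) (DataEnriched.predLoss XT)
      (fun y => DataEnriched.ols XS y.1) := by
  have hn : (n : ℝ) ≠ 0 := by
    have : n ≠ 0 := by omega
    exact_mod_cast this
  have hX : IsUnit (XSᵀ * XS) := by
    rw [hXS, Matrix.isUnit_iff_isUnit_det, Matrix.det_smul]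
    exact ((isUnit_iff_ne_zero.2 hn).pow _).mul
      ((Matrix.isUnit_iff_isUnit_det _).1 (DataEnriched.isUnit_of_rank_eq hSig))
  -- Makes `residVar XB` nonnegative, so that `h` is evaluated only where it is known to be
  -- nonnegative.
  have hdN : d ≤ N := by
    have h1 := LinearMap.finrank_le_finrank_of_injective
      (DataEnriched.toEuclideanLin_injective (X := XB)
        (hXB ▸ DataEnriched.isUnit_of_rank_eq hVB))
    simpa using h1
  constructor
  · intro Ω _ P _ β γ σS σB hσS _ YS YB hYS hYB hind h hhm hh _
    have hlaw : P.map (fun w => (YS w, YB w))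
        = (DataEnriched.linearModel XS β σS).prod (DataEnriched.linearModel XB (β + γ) σB) := by
      rw [(indepFun_iff_map_prod_eq_prod_map_map hYS.aemeasurable hYB.aemeasurable).1 hind,
        hYS.map_eq, hYB.map_eq]
    have hae : AEMeasurable (fun w => (YS w, YB w)) P := hYS.aemeasurable.prodMk hYB.aemeasurable
    obtain ⟨iE, iO, hlt⟩ := DataEnriched.enriched_dominates_ols (XB := XB) hd hm hXS hXT hX β hσS
      hhm (fun yB => hh _ (DataEnriched.residVar_nonneg hdN XB yB))
      (DataEnriched.linearModel XB (β + γ) σB)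
    rw [← hlaw] at iE iO hlt
    rw [integral_map hae iE.aestronglyMeasurable, integral_map hae iO.aestronglyMeasurable] at hlt
    exact ⟨iE.comp_aemeasurable hae, iO.comp_aemeasurable hae, hlt⟩
  · have hrisk : ∀ θ : DataEnriched.Params d,
        DataEnriched.risk (DataEnriched.jointModel XS XB) (DataEnriched.predLoss XT)
          (fun y => DataEnriched.enriched Sig XS XB (fun _ => 0) y.1 y.2) θ
        < DataEnriched.risk (DataEnriched.jointModel XS XB) (DataEnriched.predLoss XT)
          (fun y => DataEnriched.ols XS y.1) θ := by
      intro θ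
      obtain ⟨iE, iO, hlt⟩ := DataEnriched.enriched_dominates_ols (XB := XB) (h := fun _ => 0)
        hd hm hXS hXT hX θ.β θ.σS_pos measurable_const (fun _ => le_rfl)
        (DataEnriched.linearModel XB (θ.β + θ.γ) θ.σB)
      simp only [DataEnriched.risk, DataEnriched.predLoss, DataEnriched.jointModel]
      rw [← ofReal_integral_eq_lintegral_ofReal iE (.of_forall fun _ => sq_nonneg _),
        ← ofReal_integral_eq_lintegral_ofReal iO (.of_forall fun _ => sq_nonneg _)]
      exact (ENNReal.ofReal_lt_ofReal_iff_of_nonneg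
        (integral_nonneg fun _ => sq_nonneg _)).2 hlt
    -- The inequality is strict at every parameter; `β = γ = 0`, `σS = 1`, `σB = 0` is an arbitrary
    -- choice.
    exact ⟨_, DataEnriched.measurable_enriched Sig XS XB measurable_const,
      fun θ => (hrisk θ).le, ⟨0, 0, 1, 0, one_pos, le_rfl⟩, hrisk _⟩
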